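/- **Setting.** A straight-line program (SLP) of size $n$ is a sequence of rules $X_j\to a$ (a letter) or $X_j\to X_\ell X_r$ with $\ell,r<j$ ($1\le j\le n$); $\mathrm{val}(X_j)$ is the string derived from $X_j$, and the SLP represents $S=\mathrm{val}(X_n)$, with $N=|S|$. Let $P$ be a pattern of length $m$, $1\le m\le N$. For finitely many pairs of mappings $\sigma_a,\pi_a$ from letters to integers, the (summed) convolution of a string $T$ and $P$ is $$C_{T,P}[i]=\sum_a\sum_{j=1}^m \pi_a(P[j])\,\sigma_a(T[i+j-1]),\qquad 1\le i\le |T|-m+1$$ (one pair of identity mappings gives the plain convolution of two integer strings). Fix a criterion on integers that can be evaluated in constant time. An *approximate occurrence* of $P$ in $S$ is a position $1\le i\le N-m+1$ at which $C_{S,P}[i]$ meets the criterion; $occ$ is the set of these positions. For a rule $X_j\to X_\ell X_r$ let $t_j$ be the suffix of $\mathrm{val}(X_\ell)$ of length at most $m-1$ followed by the prefix of $\mathrm{val}(X_r)$ of length at most $m-1$; for $X_j\to a$ let $t_j=a$. The *basic compact representation* of the convolution consists of $n$, $m$, the rules, and for every $j$ the table of all values of $C_{t_j,P}$; it has $O(nm)$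 words. The *trie representation* consists of $n$, $m$, the rules, a trie $T$ in which every length-$m$ substring of $S$ is spelled by a directed path, for every window of length $m$ of every $t_j$ a pointer to a node of $T$ (if the window is a substring of $S$, a node at which a path spelling it ends), and for every node $v$ of $T$ of depth at least $m$ the convolution value of $P$ with the last $m$ letters on the path from the root to $v$. The size of $T$ is arbitrary; in particular $T$ may have $O(\min\{nm,N-\alpha\})$ nodes, where $\alpha=\sum_{j:\,|\mathrm{val}(X_j)|\ge m}(\mathrm{vOcc}(X_j)-1)(|t_j|-(m-1))$ and $\mathrm{vOcc}(X_j)$ is the number of nodes labelled $X_j$ in the derivation tree of $S$. The model of computation is the word RAM with word size at least $\log_2(N+R)+O(1)$, where $R$ is the number of words of the given representation, and the values $C_{S,P}[i]$ fit into signed words. **Theorem.** Given the basic compact representation of the convolution between $S$ and $P$, after a preprocessing that takes time linear in the size of the representation, the set $occ$ of all approximate occurrences of $P$ in $S$ can be output, each exactly once, in $O(1+|occ|)$ time. The same holds given the trie representation. The algorithms and the constants depend on nothing (the preprocessing and the output may evaluate the criterion at unit cost). -/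

import Mathlib

/-! ### Word RAM

Programs of a word RAM with word size `w`, in structured form (sequence, branch, loop) over unit-cost
instructions on registers and a word-addressed memory. Every arithmetic result is reduced modulo
`2 ^ w`. The only operations are constants, copying, addition, subtraction, indirect load and store,
comparison, output of a word, and `test`, which applies the unary acceptance criterion `acc`
to a signed word (the problem under consideration fixes `acc`, and it is evaluated in one step). -/

inductive Cmd : Type where
  | skip
  | const (dst : ℕ) (v : ℕ)
  | copy (dst src : ℕ)
  | plus (dst a b : ℕ)
  | minus (dst a b : ℕ)
  | load (dst addr : ℕ)
  | store (addr src : ℕ)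
  | test (dst src : ℕ)
  | output (src : ℕ)
  | seq (p q : Cmd)
  /-- branch on `reg a < reg b` -/
  | ifLt (a b : ℕ) (p q : Cmd)
  /-- loop while `reg a < reg b` -/
  | whileLt (a b : ℕ) (p : Cmd)

structure MachineState : Type where
  reg : ℕ → ℕ
  mem : ℕ → ℕ
  /-- the words output so far, in order -/
  out : List ℕ

namespace MachineState

/-- Start of a run: all registers are zero and nothing has been output. -/
def start (mem : ℕ → ℕ) : MachineState := ⟨fun _ => 0, mem, []⟩

/-- Write `v`, reduced to a word, into register `d`. -/
def setReg (w : ℕ) (s : MachineState) (d v : ℕ) : MachineState :=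
  { s with reg := Function.update s.reg d (v % 2 ^ w) }

end MachineState

/-- The word of `w` bits that stores the integer `z` in two's complement. -/
def toWord (w : ℕ) (z : ℤ) : ℕ := (z % (2 : ℤ) ^ w).toNat

/-- The signed value of a word (two's complement). -/
def ofWord (w x : ℕ) : ℤ := if 2 * x < 2 ^ w then (x : ℤ) else (x : ℤ) - (2 : ℤ) ^ w

/-- `z` is representable as a signed word of `w` bits. -/
def FitsWord (w : ℕ) (z : ℤ) : Prop := -(2 : ℤ) ^ w ≤ 2 * z ∧ 2 * z < (2 : ℤ) ^ w

/-- `Exec w acc p s s' t`: with word size `w` and criterion `acc`, the program `p` started in `s`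
halts in `s'` after exactly `t` steps. -/
inductive Exec (w : ℕ) (acc : ℤ → Bool) : Cmd → MachineState → MachineState → ℕ → Prop where
  | skip (s) : Exec w acc .skip s s 1
  | const (s d v) : Exec w acc (.const d v) s (s.setReg w d v) 1
  | copy (s d a) : Exec w acc (.copy d a) s (s.setReg w d (s.reg a)) 1
  | plus (s d a b) : Exec w acc (.plus d a b) s (s.setReg w d (s.reg a + s.reg b)) 1
  | minus (s d a b) :
      Exec w acc (.minus d a b) s (s.setReg w d (s.reg a + (2 ^ w - s.reg b % 2 ^ w))) 1
  | load (s d a) : Exec w acc (.load d a) s (s.setReg w d (s.mem (s.reg a))) 1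
  | store (s a b) :
      Exec w acc (.store a b) s { s with mem := Function.update s.mem (s.reg a) (s.reg b) } 1
  | test (s d a) :
      Exec w acc (.test d a) s (s.setReg w d (if acc (ofWord w (s.reg a)) then 1 else 0)) 1
  | output (s a) : Exec w acc (.output a) s { s with out := s.out ++ [s.reg a] } 1
  | seq {p q s s' s'' t t'} :
      Exec w acc p s s' t → Exec w acc q s' s'' t' → Exec w acc (.seq p q) s s'' (t + t')
  | ifTrue {a b p q s s' t} :
      s.reg a < s.reg b → Exec w acc p s s' t → Exec w acc (.ifLt a b p q) s s' (t + 1)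
  | ifFalse {a b p q s s' t} :
      ¬ s.reg a < s.reg b → Exec w acc q s s' t → Exec w acc (.ifLt a b p q) s s' (t + 1)
  | whileDone {a b p s} :
      ¬ s.reg a < s.reg b → Exec w acc (.whileLt a b p) s s 1
  | whileStep {a b p s s' s'' t t'} :
      s.reg a < s.reg b → Exec w acc p s s' t → Exec w acc (.whileLt a b p) s' s'' t' →
      Exec w acc (.whileLt a b p) s s'' (t + t' + 1)

/-- On the memory image `mem`, the program `pre` halts within `T₁` steps, and then the program
`enum`, started afresh on the memory that `pre` has left, halts within `T₂` steps and has output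
every element of `A` exactly once and nothing else. -/
def PreparesAndLists (pre enum : Cmd) (w : ℕ) (acc : ℤ → Bool) (mem : ℕ → ℕ)
    (T₁ T₂ : ℕ) (A : Finset ℕ) : Prop :=
  ∃ s₁ t₁, Exec w acc pre (MachineState.start mem) s₁ t₁ ∧ t₁ ≤ T₁ ∧
    ∃ s₂ t₂, Exec w acc enum (MachineState.start s₁.mem) s₂ t₂ ∧ t₂ ≤ T₂ ∧
      s₂.out.Nodup ∧ s₂.out.toFinset = A

/-! ### Convolution and approximate occurrences -/

/-- The `k`-th entry of a vector, counted from 1. -/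
def entry (V : List ℤ) (k : ℕ) : ℤ := V.getD (k - 1) 0

/-- `C[i] = ∑_{j=1}^{m} V_P[j] * V_S[i+j-1]`. -/
def convolution (VS VP : List ℤ) (i : ℕ) : ℤ :=
  ∑ j ∈ Finset.Icc 1 VP.length, entry VP j * entry VS (i + j - 1)

/-- The convolution between the strings `S` and `P`, whose characters are mapped to integers by
`σ a` and `π a`, summed over the finitely many pairs of mappings. One pair of identity mappings is
the plain convolution of two integer strings; the indicator mappings of all letters count matches. -/
def conv {α : Type} {d : ℕ} (σ π : Fin d → α → ℤ) (S P : List α) (i : ℕ) : ℤ :=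
  ∑ a, convolution (S.map (σ a)) (P.map (π a)) i

/-- The approximate occurrences of `P` in `S`: the positions `1 ≤ i ≤ N - m + 1` whose convolution
value meets the criterion. -/
def occ {α : Type} {d : ℕ} (σ π : Fin d → α → ℤ) (acc : ℤ → Bool) (S P : List α) : Finset ℕ :=
  (Finset.Icc 1 (S.length + 1 - P.length)).filter fun i => acc (conv σ π S P i) = true

/-! ### Straight-line programs -/

/-- The right-hand side of the rule for variable number `i`: a letter or two earlier variables. -/
inductive SLPRule (α : Type) (i : ℕ) : Type where
  | letter (a : α)
  | pair (l r : Fin i)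

/-- Variables are numbered `0, …, size - 1`; the last one is the start variable. -/
structure SLP (α : Type) : Type where
  size : ℕ
  size_pos : 0 < size
  rule : (i : Fin size) → SLPRule α i

namespace SLP

variable {α : Type}

/-- The earlier variable `l` of the rule of `i`, as a variable. -/
def child (G : SLP α) {i : Fin G.size} (l : Fin i) : Fin G.size := ⟨l, l.2.trans i.2⟩

/-- The string derived from a variable. -/
def val (G : SLP α) (i : Fin G.size) : List α :=
  match G.rule i with
  | .letter a => [a]
  | .pair l r => G.val (G.child l) ++ G.val (G.child r)
termination_by i.val
decreasing_by
  · exact l.2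
  · exact r.2

/-- The represented string. -/
def text (G : SLP α) : List α :=
  G.val ⟨G.size - 1, Nat.sub_lt G.size_pos Nat.one_pos⟩

/-- The string `t_j`: for a rule `X_j → X_l X_r`, the suffix of `val X_l` of length at most `m - 1`
followed by the prefix of `val X_r` of length at most `m - 1`; for `X_j → a`, the letter `a`. -/
def seam (G : SLP α) (m : ℕ) (j : Fin G.size) : List α :=
  match G.rule j with
  | .letter a => [a]
  | .pair l r =>
      (G.val (G.child l)).drop ((G.val (G.child l)).length - (m - 1)) ++
        (G.val (G.child r)).take (m - 1)

/-- The number of windows of length `m` in `t_j`. -/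
def windows (G : SLP α) (m : ℕ) (j : Fin G.size) : ℕ := (G.seam m j).length + 1 - m

/-- The number of windows of length `m` in all `t_i` with `i < j`. -/
def windowsBefore (G : SLP α) (m : ℕ) (j : ℕ) : ℕ :=
  ∑ i ∈ Finset.univ.filter (fun i : Fin G.size => i.val < j), G.windows m i

/-- The number of windows of length `m` in all `t_j`. -/
def totalWindows (G : SLP α) (m : ℕ) : ℕ := ∑ j, G.windows m j

/-- From address `base` on, `mem` holds one record of five words per variable: `0`, (any two words,
such as the code of the letter) for a letter rule, or `1, l, r` for a pair rule, followed by the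
number of entries of the table of that variable and the address of its first entry. The tables stand
one after the other behind the records. -/
def StoredAt (G : SLP α) (m : ℕ) (mem : ℕ → ℕ) (base : ℕ) : Prop :=
  ∀ j : Fin G.size,
    (match G.rule j with
      | .letter _ => mem (base + 5 * j) = 0
      | .pair l r =>
          mem (base + 5 * j) = 1 ∧ mem (base + 5 * j + 1) = l ∧ mem (base + 5 * j + 2) = r) ∧
    mem (base + 5 * j + 3) = G.windows m j ∧
    mem (base + 5 * j + 4) = base + 5 * G.size + G.windowsBefore m j

/-- The number of words of the basic representation. -/
def basicSize (G : SLP α) (m : ℕ) : ℕ := 3 + 5 * G.size + G.totalWindows m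

/-- `mem` holds the basic compact representation of the convolution: the numbers `n`, `m` and the
total length; the rules; and for every variable `X_j` the convolution between `t_j` and `P`. All
other memory cells are arbitrary. -/
structure StoresBasic {d : ℕ} (G : SLP α) (P : List α) (σ π : Fin d → α → ℤ) (w : ℕ)
    (mem : ℕ → ℕ) : Prop where
  numVars : mem 0 = G.size
  patLength : mem 1 = P.length
  total : mem 2 = G.basicSize P.length
  rules : G.StoredAt P.length mem 3
  tables : ∀ (j : Fin G.size) (k : ℕ), k < G.windows P.length j →
    mem (3 + 5 * G.size + G.windowsBefore P.length j + k) =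
      toWord w (conv σ π (G.seam P.length j) P (k + 1))

end SLP

/-! ### Tries and the trie representation -/

/-- A trie with nodes `0, …, edges`, root `0`; node `v + 1` hangs below the node `parent v` of smaller
number by an edge labelled `label v`, and siblings have distinct labels. -/
structure Trie (α : Type) : Type where
  edges : ℕ
  parent : (v : Fin edges) → Fin (v + 1)
  label : Fin edges → α
  label_inj : ∀ u v, (parent u).val = (parent v).val → label u = label v → u = v

namespace Trie

variable {α : Type}

/-- The string on the path from the root to node number `v`. -/
def path (T : Trie α) (v : ℕ) : List α :=
  match v with
  | 0 => []
  | v + 1 => if h : v < T.edges then T.path (T.parent ⟨v, h⟩) ++ [T.label ⟨v, h⟩] else []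
termination_by v
decreasing_by exact (T.parent ⟨v, h⟩).2

def depth (T : Trie α) (v : ℕ) : ℕ := (T.path v).length

/-- The suffix of length `min k (depth v)` of the path from the root to `v`. -/
def str (T : Trie α) (v k : ℕ) : List α := (T.path v).drop (T.depth v - k)

end Trie

namespace SLP

variable {α : Type}

/-- `node` points every window of length `m` of a string `t_j` that is a substring of the text to a
node of `T` at which a path spelling that window ends. -/
def Locates (G : SLP α) (m : ℕ) (T : Trie α)
    (node : Fin G.size → ℕ → Fin (T.edges + 1)) : Prop :=
  ∀ (j : Fin G.size) (k : ℕ), k < G.windows m j →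
    ((G.seam m j).drop k).take m <:+: G.text →
      m ≤ T.depth (node j k) ∧ T.str (node j k) m = ((G.seam m j).drop k).take m

/-- The number of words of the trie representation. -/
def trieSize (G : SLP α) (m : ℕ) (T : Trie α) : ℕ :=
  4 + 5 * G.size + G.totalWindows m + 3 * (T.edges + 1)

/-- `mem` holds the trie representation of the convolution: the numbers `n`, `m`, the address of the
trie and the total length; the rules; for every variable `X_j` the nodes of the trie that belong to
the windows of `t_j`; and for every node `v` of the trie a record of three words: the number of its
parent; the convolution value `C_T(v)` if `depth v ≥ m`; and any word, such as the code of the label.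
All other memory cells are arbitrary. -/
structure StoresTrie {d : ℕ} (G : SLP α) (P : List α) (σ π : Fin d → α → ℤ) (T : Trie α)
    (node : Fin G.size → ℕ → Fin (T.edges + 1)) (w : ℕ) (mem : ℕ → ℕ) : Prop where
  numVars : mem 0 = G.size
  patLength : mem 1 = P.length
  trieAddr : mem 2 = 4 + 5 * G.size + G.totalWindows P.length
  total : mem 3 = G.trieSize P.length T
  rules : G.StoredAt P.length mem 4
  tables : ∀ (j : Fin G.size) (k : ℕ), k < G.windows P.length j →
    mem (4 + 5 * G.size + G.windowsBefore P.length j + k) = node j k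
  parents : ∀ v : Fin T.edges,
    mem (4 + 5 * G.size + G.totalWindows P.length + 3 * (v + 1)) = T.parent v
  values : ∀ v : Fin (T.edges + 1), P.length ≤ T.depth v →
    mem (4 + 5 * G.size + G.totalWindows P.length + 3 * v + 1) =
      toWord w (conv σ π (T.str v P.length) P 1)

end SLP

/-! The nodes of the derivation tree, restricted to those below which there is an approximate
occurrence, form a tree in which every leaf has occurrences in its own seam `t_j`; when the chains of
nodes that have only one child and no own occurrence are contracted, at most `2 * |occ|` nodes
remain. The enumeration is a traversal of that contracted tree.

Every window of length `m` of `val X_j` lies in the left part, in the right part, or is a window of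
`t_j`, and these cases exclude each other (`SLP.mem_occAt`, `SLP.disjoint_parts`). The preprocessing
goes through the variables in increasing order. For `X_j` it computes the length of `val X_j`,
overwrites the table of `t_j` by the list of the positions of its accepted windows, and finds the
variable and the shift at which the contracted chain from `X_j` ends: `X_j` itself if it has own
occurrences or occurrences in both parts, and otherwise what is already known for the only part with
occurrences (`entry_choose`). This costs constant time for every variable and every window
(`runs_processVariable`).

The enumeration keeps a stack of pairs of a variable and a shift. The variable of an entry at height
`h` has number less than `n - h`, so that the stack takes at most linear space. The time for an entry
is bounded by a linear function of its number of occurrences, by induction on the variable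
(`runs_visit`, `entryCost_split`).

Variables that are not factors of the text may have strings whose lengths overflow the word, and
meaningless table entries. The programs treat them like the others: of the addresses used, only the
end of a list inside its own table depends on these values, and what the memory contains is stated
for the variables with `SLP.Good` only.

For the trie representation, every node in a table is first replaced by the convolution value that is
stored at it (`runs_resolveNodes`), which gives the basic representation for the variables that are
factors of the text. -/

/-! ### Total correctness with time bounds -/

/-- Total correctness: started in `s`, the program `p` halts within `T` steps in a state that
satisfies `Q`. -/
def Runs (w : ℕ) (acc : ℤ → Bool) (p : Cmd) (s : MachineState) (T : ℕ)
    (Q : MachineState → Prop) : Prop :=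
  ∃ s' t, Exec w acc p s s' t ∧ t ≤ T ∧ Q s'

/-- Sequential composition of a list of programs. -/
def Cmd.block : List Cmd → Cmd
  | [] => .skip
  | p :: ps => .seq p (Cmd.block ps)

namespace MachineState

/-- Register `d` receives `x`, which need not be a word. -/
def set (s : MachineState) (d x : ℕ) : MachineState :=
  { s with reg := Function.update s.reg d x }

/-- Memory cell `a` receives `x`. -/
def put (s : MachineState) (a x : ℕ) : MachineState :=
  { s with mem := Function.update s.mem a x }

/-- The word `x` is output. -/
def emit (s : MachineState) (x : ℕ) : MachineState :=
  { s with out := s.out ++ [x] }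

variable (s : MachineState) (d a x : ℕ)

@[simp] theorem set_reg (r : ℕ) : (s.set d x).reg r = if r = d then x else s.reg r := by
  simp [set, Function.update_apply]
@[simp] theorem set_mem : (s.set d x).mem = s.mem := rfl
@[simp] theorem set_out : (s.set d x).out = s.out := rfl
@[simp] theorem put_reg : (s.put a x).reg = s.reg := rfl
theorem put_mem (b : ℕ) : (s.put a x).mem b = if b = a then x else s.mem b := by
  simp [put, Function.update_apply]
@[simp] theorem put_out : (s.put a x).out = s.out := rfl
@[simp] theorem emit_reg : (s.emit x).reg = s.reg := rfl
@[simp] theorem emit_mem : (s.emit x).mem = s.mem := rfl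
@[simp] theorem emit_out : (s.emit x).out = s.out ++ [x] := rfl

end MachineState

section Runs

variable {w : ℕ} {acc : ℤ → Bool} {p q : Cmd} {ps : List Cmd} {s : MachineState} {T T' : ℕ}
  {Q Q' : MachineState → Prop} {a b d v x : ℕ}

theorem Runs.mono (h : Runs w acc p s T Q) (hT : T ≤ T') (hQ : ∀ s', Q s' → Q' s') :
    Runs w acc p s T' Q' := by
  obtain ⟨s', t, he, ht, hq⟩ := h
  exact ⟨s', t, he, ht.trans hT, hQ _ hq⟩

theorem Runs.skip (h : Q s) : Runs w acc .skip s (T + 1) Q :=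
  ⟨s, 1, .skip s, by omega, h⟩

theorem Runs.nil (h : Q s) : Runs w acc (.block []) s (T + 1) Q := Runs.skip h

theorem Runs.seq (T : ℕ) (h : Runs w acc p s T fun s' => Runs w acc q s' T' Q) :
    Runs w acc (.seq p q) s (T + T') Q := by
  obtain ⟨s', t, he, ht, s'', t', he', ht', hq⟩ := h
  exact ⟨s'', t + t', .seq he he', by omega, hq⟩

theorem Runs.cons (T : ℕ)
    (h : Runs w acc p s T fun s' => Runs w acc (.block ps) s' T' Q) :
    Runs w acc (.block (p :: ps)) s (T + T') Q := Runs.seq T h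

/-- A subprogram whose postcondition is known, followed by the rest of its block. -/
theorem Runs.cons' {R : MachineState → Prop} {T₁ : ℕ} (h : Runs w acc p s T₁ R)
    (hT : T₁ + T' ≤ T) (h' : ∀ s', R s' → Runs w acc (.block ps) s' T' Q) :
    Runs w acc (.block (p :: ps)) s T Q :=
  (Runs.cons T₁ (h.mono le_rfl h')).mono hT fun _ h => h

theorem Runs.step {s' : MachineState} (he : Exec w acc p s s' 1)
    (h : Runs w acc (.block ps) s' T Q) : Runs w acc (.block (p :: ps)) s (T + 1) Q := by
  obtain ⟨s'', t', he', ht', hq⟩ := h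
  exact ⟨s'', 1 + t', .seq he he', by omega, hq⟩

theorem Runs.const (x : ℕ) (hx : v % 2 ^ w = x) (h : Runs w acc (.block ps) (s.set d x) T Q) :
    Runs w acc (.block (.const d v :: ps)) s (T + 1) Q := by
  subst hx; exact Runs.step (.const s d v) h

theorem Runs.copy (x : ℕ) (hx : s.reg a % 2 ^ w = x)
    (h : Runs w acc (.block ps) (s.set d x) T Q) :
    Runs w acc (.block (.copy d a :: ps)) s (T + 1) Q := by
  subst hx; exact Runs.step (.copy s d a) h

theorem Runs.plus (x : ℕ) (hx : (s.reg a + s.reg b) % 2 ^ w = x)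
    (h : Runs w acc (.block ps) (s.set d x) T Q) :
    Runs w acc (.block (.plus d a b :: ps)) s (T + 1) Q := by
  subst hx; exact Runs.step (.plus s d a b) h

theorem Runs.minus (x : ℕ) (hx : (s.reg a + (2 ^ w - s.reg b % 2 ^ w)) % 2 ^ w = x)
    (h : Runs w acc (.block ps) (s.set d x) T Q) :
    Runs w acc (.block (.minus d a b :: ps)) s (T + 1) Q := by
  subst hx; exact Runs.step (.minus s d a b) h

theorem Runs.load (x : ℕ) (hx : s.mem (s.reg a) % 2 ^ w = x)
    (h : Runs w acc (.block ps) (s.set d x) T Q) :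
    Runs w acc (.block (.load d a :: ps)) s (T + 1) Q := by
  subst hx; exact Runs.step (.load s d a) h

theorem Runs.store (x y : ℕ) (hx : s.reg a = x) (hy : s.reg b = y)
    (h : Runs w acc (.block ps) (s.put x y) T Q) :
    Runs w acc (.block (.store a b :: ps)) s (T + 1) Q := by
  subst hx hy; exact Runs.step (.store s a b) h

theorem Runs.test (x : ℕ) (hx : (if acc (ofWord w (s.reg a)) then 1 else 0) % 2 ^ w = x)
    (h : Runs w acc (.block ps) (s.set d x) T Q) :
    Runs w acc (.block (.test d a :: ps)) s (T + 1) Q := by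
  subst hx; exact Runs.step (.test s d a) h

theorem Runs.output (x : ℕ) (hx : s.reg a = x) (h : Runs w acc (.block ps) (s.emit x) T Q) :
    Runs w acc (.block (.output a :: ps)) s (T + 1) Q := by
  subst hx; exact Runs.step (.output s a) h

theorem Runs.ifTrue (hlt : s.reg a < s.reg b) (h : Runs w acc p s T Q) :
    Runs w acc (.ifLt a b p q) s (T + 1) Q := by
  obtain ⟨s', t, he, ht, hq⟩ := h
  exact ⟨s', t + 1, .ifTrue hlt he, by omega, hq⟩

theorem Runs.ifFalse (hlt : ¬ s.reg a < s.reg b) (h : Runs w acc q s T Q) :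
    Runs w acc (.ifLt a b p q) s (T + 1) Q := by
  obtain ⟨s', t, he, ht, hq⟩ := h
  exact ⟨s', t + 1, .ifFalse hlt he, by omega, hq⟩

theorem Runs.whileDone (hlt : ¬ s.reg a < s.reg b) (h : Q s) :
    Runs w acc (.whileLt a b p) s (T + 1) Q :=
  ⟨s, 1, .whileDone hlt, by omega, h⟩

theorem Runs.whileStep (T : ℕ) (hlt : s.reg a < s.reg b)
    (h : Runs w acc p s T fun s' => Runs w acc (.whileLt a b p) s' T' Q) :
    Runs w acc (.whileLt a b p) s (T + T' + 1) Q := by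
  obtain ⟨s', t, he, ht, s'', t', he', ht', hq⟩ := h
  exact ⟨s'', t + t' + 1, .whileStep hlt he he', by omega, hq⟩

/-- A loop of `n` rounds with invariant `I`, whose running time is paid from the potential `Φ`. -/
theorem Runs.whileCount (n : ℕ) (I : ℕ → MachineState → Prop) (τ Φ : ℕ → ℕ)
    (hstep : ∀ i s, i < n → I i s → s.reg a < s.reg b ∧ Runs w acc p s (τ i) (I (i + 1)))
    (hend : ∀ s, I n s → ¬ s.reg a < s.reg b)
    (hΦ : ∀ i, i < n → τ i + Φ (i + 1) + 1 ≤ Φ i) (hΦn : 1 ≤ Φ n) (h : I 0 s) :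
    Runs w acc (.whileLt a b p) s (Φ 0) (I n) := by
  suffices H : ∀ k i s, i + k = n → I i s → Runs w acc (.whileLt a b p) s (Φ i) (I n) from
    H n 0 s (by omega) h
  intro k
  induction k with
  | zero =>
    intro i s hi hI
    obtain rfl : i = n := by omega
    obtain ⟨T, hT⟩ := Nat.exists_eq_add_of_le' hΦn
    rw [hT]
    exact Runs.whileDone (hend s hI) hI
  | succ k ih =>
    intro i s hi hI
    obtain ⟨hlt, hr⟩ := hstep i s (by omega) hI
    exact (Runs.whileStep (τ i) hlt (hr.mono le_rfl fun s' hs' => ih (i + 1) s' (by omega) hs')).mono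
      (hΦ i (by omega)) fun _ h => h

theorem minus_word {W x y : ℕ} (hy : y ≤ x) (hx : x < W) : (x + (W - y % W)) % W = x - y := by
  rw [Nat.mod_eq_of_lt (hy.trans_lt hx), show x + (W - y) = (x - y) + W by omega,
    Nat.add_mod_right, Nat.mod_eq_of_lt (by omega)]

theorem Runs.constEq (hv : v < 2 ^ w) (h : Runs w acc (.block ps) (s.set d v) T Q) :
    Runs w acc (.block (.const d v :: ps)) s (T + 1) Q :=
  Runs.const v (Nat.mod_eq_of_lt hv) h

theorem Runs.plusEq (x : ℕ) (hx : s.reg a + s.reg b = x) (hw : x < 2 ^ w)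
    (h : Runs w acc (.block ps) (s.set d x) T Q) :
    Runs w acc (.block (.plus d a b :: ps)) s (T + 1) Q :=
  Runs.plus x (by rw [hx, Nat.mod_eq_of_lt hw]) h

theorem Runs.minusEq (x : ℕ) (hx : s.reg a = x + s.reg b) (hw : x + s.reg b < 2 ^ w)
    (h : Runs w acc (.block ps) (s.set d x) T Q) :
    Runs w acc (.block (.minus d a b :: ps)) s (T + 1) Q :=
  Runs.minus x (by rw [hx, minus_word (Nat.le_add_left _ _) hw, Nat.add_sub_cancel]) h

theorem Runs.loadEq (x : ℕ) (hx : s.mem (s.reg a) = x) (hw : x < 2 ^ w)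
    (h : Runs w acc (.block ps) (s.set d x) T Q) :
    Runs w acc (.block (.load d a :: ps)) s (T + 1) Q :=
  Runs.load x (by rw [hx, Nat.mod_eq_of_lt hw]) h

theorem Runs.copyEq (x : ℕ) (hx : s.reg a = x) (hw : x < 2 ^ w)
    (h : Runs w acc (.block ps) (s.set d x) T Q) :
    Runs w acc (.block (.copy d a :: ps)) s (T + 1) Q :=
  Runs.copy x (by rw [hx, Nat.mod_eq_of_lt hw]) h

end Runs

/-! ### Occurrences in the string of a variable -/

theorem entry_map_window {α : Type} (f : α → ℤ) (S : List α) {i m j : ℕ} (hi : 1 ≤ i)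
    (hj : 1 ≤ j) (hjm : j ≤ m) :
    entry (((S.drop (i - 1)).take m).map f) (1 + j - 1) = entry (S.map f) (i + j - 1) := by
  simp only [entry, List.getD_eq_getElem?_getD, List.getElem?_map, List.getElem?_take,
    List.getElem?_drop]
  rw [if_pos (by omega), show i - 1 + (1 + j - 1 - 1) = i + j - 1 - 1 by omega]

/-- The convolution at `i` depends only on the window at `i`. -/
theorem conv_eq_conv_window {α : Type} {d : ℕ} (σ π : Fin d → α → ℤ) (S P : List α) {i : ℕ}
    (hi : 1 ≤ i) :
    conv σ π S P i = conv σ π ((S.drop (i - 1)).take P.length) P 1 := by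
  unfold conv convolution
  refine Finset.sum_congr rfl fun a _ => Finset.sum_congr rfl fun j hj => ?_
  rw [List.length_map, Finset.mem_Icc] at hj
  rw [entry_map_window _ _ hi hj.1 hj.2]

theorem mem_occ {α : Type} {d : ℕ} {σ π : Fin d → α → ℤ} {acc : ℤ → Bool} {S P : List α} {i : ℕ} :
    i ∈ occ σ π acc S P ↔
      1 ≤ i ∧ i + P.length ≤ S.length + 1 ∧ acc (conv σ π S P i) = true := by
  simp only [occ, Finset.mem_filter, Finset.mem_Icc]
  constructor
  · rintro ⟨⟨h1, h2⟩, h3⟩; exact ⟨h1, by omega, h3⟩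
  · rintro ⟨h1, h2, h3⟩; exact ⟨⟨h1, by omega⟩, h3⟩

/-- Windows of a factor `B` of `A ++ B ++ C` are windows of the whole string. -/
theorem conv_append_append {α : Type} {d : ℕ} (σ π : Fin d → α → ℤ) (A B C P : List α) {i : ℕ}
    (hi : 1 ≤ i) (hB : i + P.length ≤ B.length + 1) :
    conv σ π (A ++ B ++ C) P (A.length + i) = conv σ π B P i := by
  rw [conv_eq_conv_window σ π _ P (by omega : 1 ≤ A.length + i), conv_eq_conv_window σ π B P hi]
  congr 1
  rw [List.append_assoc, show A.length + i - 1 = A.length + (i - 1) by omega,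
    List.drop_append, List.drop_append_of_le_length (by omega)]
  simp only [List.drop_eq_nil_of_le (show A.length ≤ A.length + (i - 1) by omega), List.nil_append,
    Nat.add_sub_cancel_left]
  rw [List.take_append_of_le_length (by simp; omega)]

namespace SLP

variable {α : Type} (G : SLP α) (m : ℕ)

theorem val_letter {j : Fin G.size} {a : α} (h : G.rule j = .letter a) : G.val j = [a] := by
  rw [val, h]

theorem val_pair {j : Fin G.size} {l r : Fin j} (h : G.rule j = .pair l r) :
    G.val j = G.val (G.child l) ++ G.val (G.child r) := by
  rw [val, h]

/-- The variable occurs, as far as its string is concerned, in the text: only such variables have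
lengths and convolution values that are guaranteed to fit into words. -/
def Good (j : Fin G.size) : Prop := G.val j <:+: G.text

variable {G} in
theorem Good.left {j : Fin G.size} {l r : Fin j} (h : G.rule j = .pair l r) (hj : G.Good j) :
    G.Good (G.child l) :=
  List.IsInfix.trans ⟨[], G.val (G.child r), by rw [G.val_pair h]; simp⟩ hj

variable {G} in
theorem Good.right {j : Fin G.size} {l r : Fin j} (h : G.rule j = .pair l r) (hj : G.Good j) :
    G.Good (G.child r) :=
  List.IsInfix.trans ⟨G.val (G.child l), [], by rw [G.val_pair h]; simp⟩ hj

/-- The position in `val X_j` at which the first window of `t_j` starts, counted from 1. -/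
def firstPos (j : Fin G.size) : ℕ :=
  match G.rule j with
  | .letter _ => 1
  | .pair l _ => (G.val (G.child l)).length - (m - 1) + 1

theorem firstPos_pos (j : Fin G.size) : 1 ≤ G.firstPos m j := by
  unfold firstPos; split <;> omega

/-- The string `t_j` is the part of `val X_j` that starts at `firstPos`. -/
theorem val_eq_append_seam (j : Fin G.size) :
    ∃ A C, G.val j = A ++ G.seam m j ++ C ∧ A.length + 1 = G.firstPos m j := by
  cases h : G.rule j with
  | letter a => exact ⟨[], [], by simp [seam, firstPos, h, val_letter]⟩
  | pair l r =>
    refine ⟨(G.val (G.child l)).take ((G.val (G.child l)).length - (m - 1)),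
      (G.val (G.child r)).drop (m - 1), ?_, ?_⟩
    · simp only [seam, h, G.val_pair h, List.append_assoc, List.take_append_drop]
      rw [← List.append_assoc, List.take_append_drop]
    · simp only [firstPos, h, List.length_take]
      omega

/-- The approximate occurrences in `val X_j`. -/
def occAt {d : ℕ} (σ π : Fin d → α → ℤ) (acc : ℤ → Bool) (P : List α) (j : Fin G.size) :
    Finset ℕ := occ σ π acc (G.val j) P

/-- The approximate occurrences in `val X_j` whose windows lie in `t_j`. -/
def ownList {d : ℕ} (σ π : Fin d → α → ℤ) (acc : ℤ → Bool) (P : List α) (j : Fin G.size) :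
    List ℕ :=
  ((List.range (G.windows P.length j)).filter
    fun k => acc (conv σ π (G.seam P.length j) P (k + 1))).map (G.firstPos P.length j + ·)

/-- The approximate occurrences in `val X_j` that lie in its left part. -/
def leftOcc {d : ℕ} (σ π : Fin d → α → ℤ) (acc : ℤ → Bool) (P : List α) (j : Fin G.size) :
    Finset ℕ :=
  match G.rule j with
  | .letter _ => ∅
  | .pair l _ => G.occAt σ π acc P (G.child l)

/-- The approximate occurrences in `val X_j` that lie in its right part, as positions in
`val X_j`. -/
def rightOcc {d : ℕ} (σ π : Fin d → α → ℤ) (acc : ℤ → Bool) (P : List α) (j : Fin G.size) :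
    Finset ℕ :=
  match G.rule j with
  | .letter _ => ∅
  | .pair l r => (G.occAt σ π acc P (G.child r)).image ((G.val (G.child l)).length + ·)

variable {d : ℕ} (σ π : Fin d → α → ℤ) (acc : ℤ → Bool) (P : List α)

theorem conv_seam (j : Fin G.size) {k : ℕ} (hk : k < G.windows P.length j) :
    conv σ π (G.seam P.length j) P (k + 1) =
      conv σ π (G.val j) P (G.firstPos P.length j + k) := by
  obtain ⟨A, C, hv, hA⟩ := G.val_eq_append_seam P.length j
  unfold windows at hk
  rw [hv, ← hA, show A.length + 1 + k = A.length + (k + 1) by omega,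
    conv_append_append σ π A _ C P (by omega) (by omega)]

theorem firstPos_add_le (j : Fin G.size) {k : ℕ} (hk : k < G.windows P.length j) :
    G.firstPos P.length j + k + P.length ≤ (G.val j).length + 1 := by
  obtain ⟨A, C, hv, hA⟩ := G.val_eq_append_seam P.length j
  unfold windows at hk
  rw [hv, ← hA]
  simp only [List.length_append]
  omega

/-- A window of `t_j` is the window of the text at some position, if `val X_j` is a factor of the
text. -/
theorem exists_conv_text {j : Fin G.size} (hj : G.Good j) {k : ℕ}
    (hk : k < G.windows P.length j) :
    ∃ i, 1 ≤ i ∧ i + P.length ≤ G.text.length + 1 ∧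
      conv σ π (G.seam P.length j) P (k + 1) = conv σ π G.text P i := by
  obtain ⟨A, C, h⟩ := hj
  have h1 := G.firstPos_add_le P j hk
  have h2 := G.firstPos_pos P.length j
  refine ⟨A.length + (G.firstPos P.length j + k), by omega, ?_, ?_⟩
  · rw [← h]; simp only [List.length_append]; omega
  · rw [G.conv_seam σ π P j hk, ← h, conv_append_append σ π A _ C P (by omega) (by omega)]

theorem window_factor {j : Fin G.size} (hj : G.Good j) (k : ℕ) :
    ((G.seam m j).drop k).take m <:+: G.text := by
  obtain ⟨A, C, hv, -⟩ := G.val_eq_append_seam m j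
  refine List.IsInfix.trans ?_ hj
  rw [hv]
  exact ((List.take_prefix _ _).isInfix.trans (List.drop_suffix _ _).isInfix).trans ⟨A, C, rfl⟩

theorem mem_ownList {j : Fin G.size} {x : ℕ} :
    x ∈ G.ownList σ π acc P j ↔ ∃ k < G.windows P.length j,
      x = G.firstPos P.length j + k ∧ acc (conv σ π (G.val j) P x) = true := by
  simp only [ownList, List.mem_map, List.mem_filter, List.mem_range]
  constructor
  · rintro ⟨k, ⟨hk, ha⟩, rfl⟩
    exact ⟨k, hk, rfl, by rw [← G.conv_seam σ π P j hk]; exact ha⟩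
  · rintro ⟨k, hk, rfl, ha⟩
    exact ⟨k, ⟨hk, by rw [G.conv_seam σ π P j hk]; exact ha⟩, rfl⟩

theorem ownList_nodup (j : Fin G.size) : (G.ownList σ π acc P j).Nodup :=
  (List.nodup_range.filter _).map (add_right_injective _)

theorem ownList_length_le (j : Fin G.size) :
    (G.ownList σ π acc P j).length ≤ G.windows P.length j := by
  unfold ownList
  rw [List.length_map]
  exact (List.length_filter_le _ _).trans (by simp)

theorem occAt_bounds {j : Fin G.size} {x : ℕ} (hP : 1 ≤ P.length)
    (hx : x ∈ G.occAt σ π acc P j) : 1 ≤ x ∧ x ≤ (G.val j).length := by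
  obtain ⟨h1, h2, -⟩ := mem_occ.1 hx
  exact ⟨h1, by omega⟩

theorem windows_pair {j : Fin G.size} {l r : Fin j} (h : G.rule j = .pair l r) :
    G.windows m j = min (G.val (G.child l)).length (m - 1) +
      min (G.val (G.child r)).length (m - 1) + 1 - m := by
  simp only [windows, seam, h, List.length_append, List.length_drop, List.length_take]
  omega

/-- Every window of `val X_j` lies in the left part, in the right part, or in `t_j`. -/
theorem mem_occAt (hP : 1 ≤ P.length) {j : Fin G.size} {x : ℕ} :
    x ∈ G.occAt σ π acc P j ↔ x ∈ G.ownList σ π acc P j ∨ x ∈ G.leftOcc σ π acc P j ∨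
      x ∈ G.rightOcc σ π acc P j := by
  rw [mem_ownList]
  cases h : G.rule j with
  | letter a =>
    simp only [leftOcc, rightOcc, h, Finset.notMem_empty, or_false, occAt, mem_occ, windows, seam,
      firstPos, G.val_letter h, List.length_singleton]
    constructor
    · rintro ⟨h1, h2, h3⟩; exact ⟨x - 1, by omega, by omega, h3⟩
    · rintro ⟨k, hk, rfl, h3⟩; exact ⟨by omega, by omega, h3⟩
  | pair l r =>
    have hw := G.windows_pair P.length h
    have hf : G.firstPos P.length j = (G.val (G.child l)).length - (P.length - 1) + 1 := by
      simp only [firstPos, h]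
    have hl : ∀ x, 1 ≤ x → x + P.length ≤ (G.val (G.child l)).length + 1 →
        conv σ π (G.val j) P x = conv σ π (G.val (G.child l)) P x := by
      intro x h1 h2
      have := conv_append_append σ π [] (G.val (G.child l)) (G.val (G.child r)) P h1 h2
      simpa [G.val_pair h] using this
    have hr : ∀ x, 1 ≤ x → x + P.length ≤ (G.val (G.child r)).length + 1 →
        conv σ π (G.val j) P ((G.val (G.child l)).length + x) =
          conv σ π (G.val (G.child r)) P x := by
      intro x h1 h2
      have := conv_append_append σ π (G.val (G.child l)) (G.val (G.child r)) [] P h1 h2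
      simpa [G.val_pair h] using this
    have hlen : (G.val j).length = (G.val (G.child l)).length + (G.val (G.child r)).length := by
      rw [G.val_pair h, List.length_append]
    simp only [leftOcc, rightOcc, h, Finset.mem_image, occAt, mem_occ]
    constructor
    · rintro ⟨h1, h2, h3⟩
      by_cases hc : x + P.length ≤ (G.val (G.child l)).length + 1
      · exact .inr (.inl ⟨h1, hc, by rw [← hl x h1 hc]; exact h3⟩)
      · by_cases hc' : (G.val (G.child l)).length < x
        · refine .inr (.inr ⟨x - (G.val (G.child l)).length, ⟨by omega, by omega, ?_⟩,
            by omega⟩)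
          rw [← hr _ (by omega) (by omega), Nat.add_sub_cancel' hc'.le]
          exact h3
        · exact .inl ⟨x - G.firstPos P.length j, by omega, by omega, h3⟩
    · rintro (⟨k, hk, hx, h3⟩ | ⟨h1, h2, h3⟩ | ⟨y, ⟨h1, h2, h3⟩, rfl⟩)
      · exact ⟨by omega, by omega, h3⟩
      · exact ⟨h1, by omega, by rw [hl x h1 h2]; exact h3⟩
      · exact ⟨by omega, by omega, by rw [hr y h1 h2]; exact h3⟩

/-- A window of `t_j` crosses the border between the two parts of `val X_j`. -/
theorem disjoint_parts (hP : 1 ≤ P.length) (j : Fin G.size) :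
    Disjoint (G.ownList σ π acc P j).toFinset (G.leftOcc σ π acc P j) ∧
    Disjoint (G.ownList σ π acc P j).toFinset (G.rightOcc σ π acc P j) ∧
    Disjoint (G.leftOcc σ π acc P j) (G.rightOcc σ π acc P j) := by
  simp only [Finset.disjoint_left, List.mem_toFinset, mem_ownList]
  cases h : G.rule j with
  | letter a => simp [leftOcc, rightOcc, h]
  | pair l r =>
    have hw := G.windows_pair P.length h
    have hf : G.firstPos P.length j = (G.val (G.child l)).length - (P.length - 1) + 1 := by
      simp only [firstPos, h]
    simp only [leftOcc, rightOcc, h, Finset.mem_image, occAt, mem_occ]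
    refine ⟨?_, ?_, ?_⟩
    · rintro x ⟨k, hk, hx, -⟩ ⟨h1, h2, -⟩; omega
    · rintro x ⟨k, hk, hx, -⟩ ⟨y, ⟨h1, h2, -⟩, hy⟩; omega
    · rintro x ⟨h1, h2, -⟩ ⟨y, ⟨h3, h4, -⟩, hy⟩; omega

theorem card_occAt (hP : 1 ≤ P.length) (j : Fin G.size) :
    (G.occAt σ π acc P j).card = (G.ownList σ π acc P j).length +
      (G.leftOcc σ π acc P j).card + (G.rightOcc σ π acc P j).card := by
  obtain ⟨h1, h2, h3⟩ := G.disjoint_parts σ π acc P hP j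
  rw [← List.toFinset_card_of_nodup (G.ownList_nodup σ π acc P j),
    ← Finset.card_union_of_disjoint h1,
    ← Finset.card_union_of_disjoint (Finset.disjoint_union_left.2 ⟨h2, h3⟩)]
  congr 1
  ext x
  rw [G.mem_occAt σ π acc P hP]
  simp

/-! ### Numbers of windows -/

theorem windowsBefore_zero : G.windowsBefore m 0 = 0 := by
  simp [windowsBefore]

theorem windowsBefore_succ (j : Fin G.size) :
    G.windowsBefore m (j + 1) = G.windowsBefore m j + G.windows m j := by
  unfold windowsBefore
  rw [add_comm (Finset.sum _ _), ← Finset.sum_insert (by simp)]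
  refine Finset.sum_congr ?_ fun _ _ => rfl
  ext i
  simp only [Finset.mem_filter, Finset.mem_univ, true_and, Finset.mem_insert, Fin.ext_iff]
  omega

theorem windowsBefore_size : G.windowsBefore m G.size = G.totalWindows m := by
  simp [windowsBefore, totalWindows]

theorem windowsBefore_mono {i j : ℕ} (h : i ≤ j) :
    G.windowsBefore m i ≤ G.windowsBefore m j :=
  Finset.sum_le_sum_of_subset fun x hx => by
    simp only [Finset.mem_filter, Finset.mem_univ, true_and] at hx ⊢; omega

theorem windowsBefore_le (j : Fin G.size) :
    G.windowsBefore m j + G.windows m j ≤ G.totalWindows m := by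
  rw [← windowsBefore_succ, ← windowsBefore_size]
  exact G.windowsBefore_mono m j.2

end SLP

/-! ### The memory layout of the enumeration structure -/

section Layout

variable {α : Type} {d : ℕ} (σ π : Fin d → α → ℤ) (acc : ℤ → Bool) (G : SLP α) (P : List α)

/-- `(a, o)` represents the set `O ⊆ {1, …, len}` of positions: either `O` is empty and `a = 0`, or
`a` is the address of the block of a variable numbered below `bound` that has windows of its own or
occurrences on both sides, and `O` consists of its occurrences shifted by `o`. The blocks of nine
words stand from address `F` on. -/
def Entry (F : ℕ) (O : Finset ℕ) (len bound a o : ℕ) : Prop :=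
  (O = ∅ ∧ a = 0) ∨ ∃ j : Fin G.size, j.val < bound ∧ a = F + 9 * j ∧ G.Good j ∧
    o + (G.val j).length ≤ len ∧ O = (G.occAt σ π acc P j).image (o + ·) ∧
    (G.ownList σ π acc P j ≠ [] ∨ (G.leftOcc σ π acc P j).Nonempty ∧
      (G.rightOcc σ π acc P j).Nonempty)

/-- The block of the variable `X_j` in the memory `mem`: the bounds of the list of its own
occurrences, which stands at address `t`; the entries of its left and of its right part; the length
of its string; and the entry of the variable itself. -/
structure Block (F : ℕ) (j : Fin G.size) (t : ℕ) (mem : ℕ → ℕ) : Prop where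
  first : mem (F + 9 * j) = t
  last : mem (F + 9 * j + 1) = t + (G.ownList σ π acc P j).length
  own : ∀ k (h : k < (G.ownList σ π acc P j).length), mem (t + k) = (G.ownList σ π acc P j)[k]
  left : Entry σ π acc G P F (G.leftOcc σ π acc P j) (G.val j).length j
    (mem (F + 9 * j + 2)) (mem (F + 9 * j + 3))
  right : Entry σ π acc G P F (G.rightOcc σ π acc P j) (G.val j).length j
    (mem (F + 9 * j + 4)) (mem (F + 9 * j + 5))
  length : mem (F + 9 * j + 6) = (G.val j).length
  self : Entry σ π acc G P F (G.occAt σ π acc P j) (G.val j).length (j + 1)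
    (mem (F + 9 * j + 7)) (mem (F + 9 * j + 8))

variable {σ π acc G P}

theorem Block.congr {F t : ℕ} {j : Fin G.size} {mem mem' : ℕ → ℕ}
    (h : Block σ π acc G P F j t mem)
    (hb : ∀ a, F + 9 * j ≤ a → a < F + 9 * (j + 1) → mem' a = mem a)
    (ht : ∀ a, t ≤ a → a < t + G.windows P.length j → mem' a = mem a) :
    Block σ π acc G P F j t mem' := by
  have hl := G.ownList_length_le σ π acc P j
  constructor
  · rw [hb _ (by omega) (by omega)]; exact h.first
  · rw [hb _ (by omega) (by omega)]; exact h.last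
  · intro k hk; rw [ht _ (by omega) (by omega)]; exact h.own k hk
  · rw [hb _ (by omega) (by omega), hb _ (by omega) (by omega)]; exact h.left
  · rw [hb _ (by omega) (by omega), hb _ (by omega) (by omega)]; exact h.right
  · rw [hb _ (by omega) (by omega)]; exact h.length
  · rw [hb _ (by omega) (by omega), hb _ (by omega) (by omega)]; exact h.self

end Layout

/-! ### The enumeration program -/

/-- Outputs the words in the memory cells from address `reg 8` to `reg 9`, increased by `reg 7`. -/
def listOwn : Cmd :=
  .whileLt 8 9 (.block [.load 14 8, .plus 14 14 7, .output 14, .plus 8 8 1])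

/-- Takes an entry from the stack, whose end is in `reg 5`, outputs the own occurrences of its
variable, and puts the entries of the two parts on the stack. -/
def visit : Cmd :=
  .block [.minus 5 5 1, .load 7 5, .minus 5 5 1, .load 6 5,
    .ifLt 0 6
      (.block [.load 8 6, .plus 6 6 1, .load 9 6, .plus 6 6 1, .load 10 6, .plus 6 6 1,
        .load 11 6, .plus 6 6 1, .load 12 6, .plus 6 6 1, .load 13 6, listOwn,
        .store 5 10, .plus 5 5 1, .plus 11 11 7, .store 5 11, .plus 5 5 1,
        .store 5 12, .plus 5 5 1, .plus 13 13 7, .store 5 13, .plus 5 5 1])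
      .skip]

/-- Traverses the derivation tree without its unary parts, by means of a stack. -/
def enumerate : Cmd :=
  .block [.const 1 1, .load 4 0, .const 5 2, .plus 5 5 4, .whileLt 4 5 visit]

theorem runs_listOwn {w : ℕ} {acc : ℤ → Bool} (s : MachineState) (t δ : ℕ) (L : List ℕ)
    (h1 : s.reg 1 = 1) (h7 : s.reg 7 = δ) (h8 : s.reg 8 = t) (h9 : s.reg 9 = t + L.length)
    (hL : ∀ k (h : k < L.length), s.mem (t + k) = L[k])
    (hw : t + L.length < 2 ^ w) (hδ : ∀ x ∈ L, δ + x < 2 ^ w) :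
    Runs w acc listOwn s (6 * L.length + 1) fun s' =>
      s'.mem = s.mem ∧ s'.out = s.out ++ L.map (δ + ·) ∧
        ∀ r, r ≠ 8 → r ≠ 14 → s'.reg r = s.reg r := by
  refine (Runs.whileCount L.length (fun k s' => s'.reg 8 = t + k ∧ s'.mem = s.mem ∧
    s'.out = s.out ++ (L.take k).map (δ + ·) ∧ ∀ r, r ≠ 8 → r ≠ 14 → s'.reg r = s.reg r)
    (fun _ => 5) (fun k => 6 * (L.length - k) + 1) ?_ ?_ ?_ ?_ ?_).mono le_rfl ?_
  · rintro k s' hk ⟨i8, im, io, ir⟩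
    have i9 := (ir 9 (by decide) (by decide)).trans h9
    have i7 := (ir 7 (by decide) (by decide)).trans h7
    have i1 := (ir 1 (by decide) (by decide)).trans h1
    have hk' := hδ _ (List.getElem_mem hk)
    refine ⟨by omega, ?_⟩
    refine Runs.load L[k] (by rw [i8, im, hL k hk, Nat.mod_eq_of_lt (by omega)]) ?_
    refine Runs.plus (δ + L[k]) (by
      simp [i7]; rw [Nat.mod_eq_of_lt (by omega)]; omega) ?_
    refine Runs.output (δ + L[k]) (by simp) ?_
    refine Runs.plus (t + (k + 1)) (by simp [i8, i1]; rw [Nat.mod_eq_of_lt (by omega)]; omega) ?_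
    refine Runs.nil ⟨by simp, by simpa using im, ?_, ?_⟩
    · rw [List.take_add_one, List.getElem?_eq_getElem hk]
      simp only [MachineState.set_out, MachineState.emit_out, io, List.map_append,
        Option.toList_some, List.map_cons, List.map_nil, List.append_assoc]
    · intro r h8 h14; simp [h8, h14, ir r h8 h14]
  · rintro s' ⟨i8, -, -, ir⟩
    rw [i8, ir 9 (by decide) (by decide), h9]
    omega
  · intro i hi; omega
  · simp
  · exact ⟨by simpa using h8, rfl, by simp, fun _ _ _ => rfl⟩
  · rintro s' ⟨-, im, io, ir⟩
    exact ⟨im, by simpa using io, ir⟩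

/-- The time for an entry with `k` positions, the constants being chosen so that a variable with own
occurrences pays for two empty entries and a variable with two nonempty parts is paid by the
reserve of one of them. -/
def entryCost (k : ℕ) : ℕ := if k = 0 then 8 else 104 * k - 41

theorem entryCost_split (k l r : ℕ) (h : k ≠ 0 ∨ l ≠ 0 ∧ r ≠ 0) :
    6 * k + 41 + entryCost l + entryCost r ≤ entryCost (k + l + r) := by
  unfold entryCost
  split_ifs <;> omega

theorem Entry.card_eq_zero {α : Type} {d : ℕ} {σ π : Fin d → α → ℤ} {acc : ℤ → Bool} {G : SLP α}
    {P : List α} {F len bound a o : ℕ} {O : Finset ℕ} (hP : 1 ≤ P.length)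
    (h : Entry σ π acc G P F O len bound a o) : a = 0 ∨ O.card ≠ 0 := by
  rcases h with ⟨-, h⟩ | ⟨j, -, -, -, -, rfl, h⟩
  · exact .inl h
  · right
    rw [Finset.card_image_of_injective _ (add_right_injective o), G.card_occAt σ π acc P hP]
    rcases h with h | ⟨h, -⟩
    · have := List.length_pos_iff.2 h; omega
    · have := h.card_pos; omega

/-- Listings of the three parts of `val X_j` make up a listing of its occurrences. -/
theorem SLP.listing {α : Type} {d : ℕ} {σ π : Fin d → α → ℤ} {acc : ℤ → Bool} (G : SLP α)
    {P : List α} (hP : 1 ≤ P.length) {j : Fin G.size} {XL XR : List ℕ} (o δ : ℕ)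
    (qn : XR.Nodup) (qX : ∀ x, x ∈ XR ↔ ∃ p ∈ G.rightOcc σ π acc P j, x = δ + o + p)
    (pn : XL.Nodup) (pX : ∀ x, x ∈ XL ↔ ∃ p ∈ G.leftOcc σ π acc P j, x = δ + o + p) :
    ((G.ownList σ π acc P j).map (δ + o + ·) ++ (XR ++ XL)).Nodup ∧
    ∀ x, x ∈ (G.ownList σ π acc P j).map (δ + o + ·) ++ (XR ++ XL) ↔
      ∃ p ∈ (G.occAt σ π acc P j).image (o + ·), x = δ + p := by
  constructor
  · obtain ⟨d1, d2, d3⟩ := G.disjoint_parts σ π acc P hP j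
    simp only [Finset.disjoint_left, List.mem_toFinset] at d1 d2 d3
    refine List.nodup_append'.2 ⟨(G.ownList_nodup σ π acc P j).map (add_right_injective _),
      List.nodup_append'.2 ⟨qn, pn, ?_⟩, ?_⟩
    · intro x hx hx'
      obtain ⟨p, hp, rfl⟩ := (qX x).1 hx
      obtain ⟨p', hp', he⟩ := (pX _).1 hx'
      obtain rfl : p = p' := by omega
      exact d3 hp' hp
    · intro x hx hx'
      obtain ⟨p, hp, rfl⟩ := List.mem_map.1 hx
      rcases List.mem_append.1 hx' with hx' | hx'
      · obtain ⟨p', hp', he⟩ := (qX _).1 hx'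
        obtain rfl : p = p' := by omega
        exact d2 hp hp'
      · obtain ⟨p', hp', he⟩ := (pX _).1 hx'
        obtain rfl : p = p' := by omega
        exact d1 hp hp'
  · intro x
    simp only [List.mem_append, List.mem_map, qX, pX, Finset.mem_image,
      G.mem_occAt σ π acc P hP]
    constructor
    · rintro (⟨p, hp, rfl⟩ | ⟨p, hp, rfl⟩ | ⟨p, hp, rfl⟩)
      · exact ⟨o + p, ⟨p, .inl hp, rfl⟩, by omega⟩
      · exact ⟨o + p, ⟨p, .inr (.inr hp), rfl⟩, by omega⟩
      · exact ⟨o + p, ⟨p, .inr (.inl hp), rfl⟩, by omega⟩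
    · rintro ⟨-, ⟨p, hp | hp | hp, rfl⟩, rfl⟩
      · exact .inl ⟨p, hp, by omega⟩
      · exact .inr (.inr ⟨p, hp, by omega⟩)
      · exact .inr (.inl ⟨p, hp, by omega⟩)

theorem runs_visit_block {w : ℕ} {acc : ℤ → Bool} (s : MachineState)
    {p sp t δ LN LO RN RO : ℕ} {L : List ℕ} (h0 : s.reg 0 = 0) (h1 : s.reg 1 = 1)
    (h5 : s.reg 5 = sp + 2) (hp : 0 < p) (hpw : p + 5 < 2 ^ w) (hsp : sp + 4 < 2 ^ w)
    (m0 : s.mem sp = p) (m1 : s.mem (sp + 1) = δ) (hδ : δ < 2 ^ w)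
    (b0 : s.mem p = t) (b1 : s.mem (p + 1) = t + L.length) (b2 : s.mem (p + 2) = LN)
    (b3 : s.mem (p + 3) = LO) (b4 : s.mem (p + 4) = RN) (b5 : s.mem (p + 5) = RO)
    (ht : t + L.length < 2 ^ w) (hL : ∀ k (h : k < L.length), s.mem (t + k) = L[k])
    (hδL : ∀ x ∈ L, δ + x < 2 ^ w) (hLN : LN < 2 ^ w) (hRN : RN < 2 ^ w) :
    Runs w acc visit s (6 * L.length + 40) fun s' =>
      s'.reg 0 = 0 ∧ s'.reg 1 = 1 ∧ s'.reg 4 = s.reg 4 ∧ s'.reg 5 = sp + 4 ∧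
      s'.mem sp = LN ∧ s'.mem (sp + 1) = (δ + LO) % 2 ^ w ∧
      s'.mem (sp + 2) = RN ∧ s'.mem (sp + 3) = (δ + RO) % 2 ^ w ∧
      (∀ x < sp, s'.mem x = s.mem x) ∧ s'.out = s.out ++ L.map (δ + ·) := by
  refine Runs.minusEq (sp + 1) (by omega) (by omega) ?_
  refine Runs.loadEq δ (by simp [m1]) hδ ?_
  refine Runs.minusEq sp (by simp [h1]) (by simp [h1]; omega) ?_
  refine Runs.loadEq p (by simp [m0]) (by omega) ?_
  refine Runs.cons (T := 6 * L.length + 35) (T' := 1) (Runs.ifTrue (by simpa [h0] using hp) ?_)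
  refine Runs.loadEq t (by simp [b0]) (by omega) ?_
  refine Runs.plusEq (p + 1) (by simp [h1]) (by omega) ?_
  refine Runs.loadEq (t + L.length) (by simp [b1]) ht ?_
  refine Runs.plusEq (p + 2) (by simp [h1]) (by omega) ?_
  refine Runs.loadEq LN (by simp [b2]) hLN ?_
  refine Runs.plusEq (p + 3) (by simp [h1]) (by omega) ?_
  refine Runs.load (LO % 2 ^ w) (by simp [b3]) ?_
  refine Runs.plusEq (p + 4) (by simp [h1]) (by omega) ?_
  refine Runs.loadEq RN (by simp [b4]) hRN ?_
  refine Runs.plusEq (p + 5) (by simp [h1]) (by omega) ?_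
  refine Runs.load (RO % 2 ^ w) (by simp [b5]) ?_
  refine Runs.cons' (T' := 22) (runs_listOwn _ t δ L (by simp [h1]) (by simp) (by simp) (by simp)
    (by simpa using hL) ht hδL) (by omega) ?_
  rintro s₁ ⟨sm, so, sr⟩
  simp only [MachineState.set_mem] at sm
  simp only [MachineState.set_out] at so
  have r0 : s₁.reg 0 = 0 := by rw [sr _ (by decide) (by decide)]; simp [h0]
  have r1 : s₁.reg 1 = 1 := by rw [sr _ (by decide) (by decide)]; simp [h1]
  have r4 : s₁.reg 4 = s.reg 4 := by rw [sr _ (by decide) (by decide)]; simp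
  have r5 : s₁.reg 5 = sp := by rw [sr _ (by decide) (by decide)]; simp
  have r7 : s₁.reg 7 = δ := by rw [sr _ (by decide) (by decide)]; simp
  have r10 : s₁.reg 10 = LN := by rw [sr _ (by decide) (by decide)]; simp
  have r11 : s₁.reg 11 = LO % 2 ^ w := by rw [sr _ (by decide) (by decide)]; simp
  have r12 : s₁.reg 12 = RN := by rw [sr _ (by decide) (by decide)]; simp
  have r13 : s₁.reg 13 = RO % 2 ^ w := by rw [sr _ (by decide) (by decide)]; simp
  refine Runs.store sp LN r5 r10 ?_
  refine Runs.plusEq (sp + 1) (by simp [r5, r1]) (by omega) ?_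
  refine Runs.plus ((δ + LO) % 2 ^ w) (by simp [r11, r7, add_comm]) ?_
  refine Runs.store (sp + 1) ((δ + LO) % 2 ^ w) (by simp) (by simp) ?_
  refine Runs.plusEq (sp + 2) (by simp [r1]) (by omega) ?_
  refine Runs.store (sp + 2) RN (by simp) (by simp [r12]) ?_
  refine Runs.plusEq (sp + 3) (by simp [r1]) (by omega) ?_
  refine Runs.plus ((δ + RO) % 2 ^ w) (by simp [r13, r7, add_comm]) ?_
  refine Runs.store (sp + 3) ((δ + RO) % 2 ^ w) (by simp) (by simp) ?_
  refine Runs.plusEq (sp + 4) (by simp [r1]) (by omega) ?_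
  refine Runs.mono (T := 2) (Runs.nil (Runs.nil ?_)) (by omega) fun _ h => h
  refine ⟨by simp [r0], by simp [r1], by simp [r4], by simp, by simp [MachineState.put_mem],
    by simp [MachineState.put_mem], by simp [MachineState.put_mem], by simp [MachineState.put_mem],
    ?_, by simpa using so⟩
  intro x hx
  simp only [MachineState.set_mem, MachineState.put_mem]
  rw [if_neg (by omega), if_neg (by omega), if_neg (by omega), if_neg (by omega), sm]

/-- The program empties an entry off the stack, with everything that it gives rise to, before it
touches the stack below. -/
theorem runs_visit {α : Type} {d : ℕ} {σ π : Fin d → α → ℤ} {acc : ℤ → Bool} {G : SLP α}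
    {P : List α} {F w : ℕ} {M : ℕ → ℕ} (hP : 1 ≤ P.length) (hF : 0 < F)
    (hM : ∀ j, G.Good j → ∃ t, t + G.windows P.length j ≤ F ∧ Block σ π acc G P F j t M)
    (hw : F + 11 * G.size + 4 < 2 ^ w) (hN : G.text.length < 2 ^ w) (bound : ℕ) :
    ∀ (h : ℕ) (O : Finset ℕ) (len a o δ : ℕ) (s : MachineState) (T : ℕ)
      (Q : MachineState → Prop), Entry σ π acc G P F O len bound a o → δ + len ≤ G.text.length →
      h + bound ≤ G.size → s.reg 0 = 0 → s.reg 1 = 1 → s.reg 4 = F + 9 * G.size →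
      s.reg 5 = F + 9 * G.size + 2 * h + 2 → s.mem (F + 9 * G.size + 2 * h) = a →
      s.mem (F + 9 * G.size + 2 * h + 1) = (δ + o) % 2 ^ w →
      (∀ x < F + 9 * G.size, s.mem x = M x) →
      (∀ s', s'.reg 0 = 0 → s'.reg 1 = 1 → s'.reg 4 = F + 9 * G.size →
        s'.reg 5 = F + 9 * G.size + 2 * h →
        (∀ x < F + 9 * G.size + 2 * h, s'.mem x = s.mem x) →
        (∃ X : List ℕ, s'.out = s.out ++ X ∧ X.Nodup ∧ ∀ x, x ∈ X ↔ ∃ p ∈ O, x = δ + p) →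
        Runs w acc (.whileLt 4 5 visit) s' T Q) →
      Runs w acc (.whileLt 4 5 visit) s (entryCost O.card + T) Q := by
  induction bound using Nat.strong_induction_on with
  | _ bound ih =>
  intro h O len a o δ s T Q hE hδ hh h0 h1 h4 h5 hma hmo hmem hQ
  have hrec := hE
  rcases hE with ⟨rfl, rfl⟩ | ⟨j, hj, ha, hgood, hoj, hO, hprop⟩
  · have hc : entryCost (∅ : Finset ℕ).card + T = 7 + T + 1 := by simp [entryCost]; omega
    rw [hc]
    refine Runs.whileStep 7 (by omega) ?_
    refine Runs.minusEq (F + 9 * G.size + 2 * h + 1) (by omega) (by omega) ?_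
    refine Runs.load _ rfl ?_
    refine Runs.minusEq (F + 9 * G.size + 2 * h) (by simp [h1]) (by simp [h1]; omega) ?_
    refine Runs.loadEq 0 (by simp [hma]) (by omega) ?_
    refine Runs.cons (T := 2) (T' := 1) (Runs.ifFalse (by simp [h0]) (Runs.skip (Runs.nil ?_)))
    exact hQ _ (by simp [h0]) (by simp [h1]) (by simp [h4]) (by simp) (by simp)
      ⟨[], by simp, List.nodup_nil, by simp⟩
  · obtain ⟨t, htF, hB⟩ := hM j hgood
    have hjn := j.2
    have hk := G.ownList_length_le σ π acc P j
    have hcard : O.card = (G.ownList σ π acc P j).length + (G.leftOcc σ π acc P j).card +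
        (G.rightOcc σ π acc P j).card := by
      rw [hO, Finset.card_image_of_injective _ (add_right_injective o), G.card_occAt σ π acc P hP]
    have hsplit := entryCost_split (G.ownList σ π acc P j).length (G.leftOcc σ π acc P j).card
      (G.rightOcc σ π acc P j).card (by
        rcases hprop with h | ⟨h, h'⟩
        · exact .inl (by simpa using h)
        · exact .inr ⟨h.card_pos.ne', h'.card_pos.ne'⟩)
    rw [← hcard] at hsplit
    have hown : ∀ x ∈ G.ownList σ π acc P j, δ + o + x < 2 ^ w := by
      intro x hx
      have := (G.occAt_bounds σ π acc P hP ((G.mem_occAt σ π acc P hP).2 (.inl hx))).2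
      omega
    rw [Nat.mod_eq_of_lt (by omega)] at hmo
    have b0 : s.mem (F + 9 * j) = t := (hmem _ (by omega)).trans hB.first
    have b1 : s.mem (F + 9 * j + 1) = t + (G.ownList σ π acc P j).length :=
      (hmem _ (by omega)).trans hB.last
    obtain ⟨LN, b2⟩ : ∃ x, s.mem (F + 9 * j + 2) = x := ⟨_, rfl⟩
    obtain ⟨LO, b3⟩ : ∃ x, s.mem (F + 9 * j + 3) = x := ⟨_, rfl⟩
    obtain ⟨RN, b4⟩ : ∃ x, s.mem (F + 9 * j + 4) = x := ⟨_, rfl⟩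
    obtain ⟨RO, b5⟩ : ∃ x, s.mem (F + 9 * j + 5) = x := ⟨_, rfl⟩
    have hL := hB.left
    rw [← hmem _ (by omega), ← hmem _ (by omega), b2, b3] at hL
    have hR := hB.right
    rw [← hmem _ (by omega), ← hmem _ (by omega), b4, b5] at hR
    refine Runs.mono (T := 6 * (G.ownList σ π acc P j).length + 40 +
      (entryCost (G.rightOcc σ π acc P j).card + (entryCost (G.leftOcc σ π acc P j).card + T)) + 1)
      ?_ (by omega) fun _ h => h
    refine Runs.whileStep _ (by omega) ((runs_visit_block s (sp := F + 9 * G.size + 2 * h)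
      (p := F + 9 * j) (t := t) h0 h1 h5 (by omega) (by omega) (by omega) (hma.trans ha) hmo
      (by omega) b0 b1 b2 b3 b4 b5 (by omega)
      (fun k hk => (hmem _ (by omega)).trans (hB.own k hk)) hown ?_ ?_).mono (by omega) ?_)
    · rcases hL with ⟨-, h⟩ | ⟨i, hi, h, -⟩ <;> omega
    · rcases hR with ⟨-, h⟩ | ⟨i, hi, h, -⟩ <;> omega
    rintro s₁ ⟨r0, r1, r4, r5, n0, n1, n2, n3, sm, so⟩
    -- The entry of the right part is on top; below it, at the old height, is that of the left part.
    clear b0 b1 b2 b3 b4 b5 hmo hma hown hprop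
    refine ih j hj (h + 1) _ _ RN RO (δ + o) _ _ _ hR (by omega) (by omega) r0 r1
      (r4.trans h4) (by omega) n2 n3 (fun x hx => (sm x (by omega)).trans (hmem x hx)) ?_
    rintro s₂ q0 q1 q4 q5 qm ⟨XR, qo, qn, qX⟩
    refine ih j hj h _ _ LN LO (δ + o) _ _ _ hL (by omega) (by omega) q0 q1 q4 (by omega)
      ((qm _ (by omega)).trans n0) ((qm _ (by omega)).trans n1)
      (fun x hx => (qm x (by omega)).trans ((sm x (by omega)).trans (hmem x hx))) ?_
    rintro s₃ p0 p1 p4 p5 pm ⟨XL, po, pn, pX⟩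
    refine hQ _ p0 p1 p4 p5
      (fun x hx => (pm x hx).trans ((qm x (by omega)).trans (sm x hx)))
      ⟨(G.ownList σ π acc P j).map (δ + o + ·) ++ (XR ++ XL), ?_, ?_, ?_⟩
    · rw [po, qo, so]; simp only [List.append_assoc]
    · exact (G.listing hP o δ qn qX pn pX).1
    · rw [hO]
      exact (G.listing hP o δ qn qX pn pX).2

theorem runs_enumerate {α : Type} {d : ℕ} {σ π : Fin d → α → ℤ} {acc : ℤ → Bool} {G : SLP α}
    {P : List α} {F w a o : ℕ} {M : ℕ → ℕ} (hP : 1 ≤ P.length) (hF : 0 < F)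
    (hM : ∀ j, G.Good j → ∃ t, t + G.windows P.length j ≤ F ∧ Block σ π acc G P F j t M)
    (hw : F + 11 * G.size + 4 < 2 ^ w) (hN : G.text.length < 2 ^ w)
    (h0 : M 0 = F + 9 * G.size) (ha : M (F + 9 * G.size) = a)
    (ho : M (F + 9 * G.size + 1) = o % 2 ^ w)
    (hE : Entry σ π acc G P F (occ σ π acc G.text P) G.text.length G.size a o) :
    Runs w acc enumerate (.start M) (104 * (1 + (occ σ π acc G.text P).card)) fun s =>
      s.out.Nodup ∧ s.out.toFinset = occ σ π acc G.text P := by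
  refine Runs.mono (T := (entryCost (occ σ π acc G.text P).card + 1) + 1 + 4) ?_
    (by unfold entryCost; split_ifs <;> omega) fun _ h => h
  refine Runs.constEq (by omega) ?_
  refine Runs.loadEq (F + 9 * G.size) (by simp [MachineState.start, h0]) (by omega) ?_
  refine Runs.constEq (by omega) ?_
  refine Runs.plusEq (F + 9 * G.size + 2) (by simp [add_comm]) (by omega) ?_
  refine Runs.cons (T' := 1) _ ?_
  refine runs_visit hP hF hM hw hN G.size 0 _ _ a o 0 _ _ _ hE (by omega) (by omega)
    (by simp [MachineState.start]) (by simp) (by simp) (by simp) (by simpa [MachineState.start])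
    (by simpa [MachineState.start]) (by simp [MachineState.start]) ?_
  rintro s' - - r4 r5 - ⟨X, hX, hn, hm⟩
  refine Runs.whileDone (by omega) (Runs.nil ?_)
  have hX' : s'.out = X := by simpa [MachineState.start] using hX
  rw [hX']
  exact ⟨hn, by ext x; simp [hm]⟩

/-! ### The preprocessing program -/

/-- Reads the record at address `reg 5` and moves `reg 5` to the next record. -/
def readRule : Cmd :=
  .block [.load 10 5, .plus 5 5 1, .load 11 5, .plus 5 5 1, .load 12 5, .plus 5 5 1, .load 13 5,
    .plus 5 5 1, .load 14 5, .plus 5 5 1]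

/-- Computes the length in `reg 15`, the first position of the seam in `reg 16`, and the entries of
the two parts in `reg 20`, …, `reg 23`. The block of variable `l` stands at address `F + 9 * l`; its
last three words are the length and the entry of `l`. -/
def combine : Cmd :=
  .ifLt 10 1
    (.block [.const 15 1, .const 16 1, .const 20 0, .const 21 0, .const 22 0, .const 23 0])
    (.block [.plus 17 11 11, .plus 17 17 17, .plus 17 17 17, .plus 17 17 11, .plus 17 17 2,
      .const 18 6, .plus 17 17 18, .load 24 17, .plus 17 17 1, .load 20 17, .plus 17 17 1,
      .load 21 17,
      .plus 17 12 12, .plus 17 17 17, .plus 17 17 17, .plus 17 17 12, .plus 17 17 2,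
      .plus 17 17 18, .load 15 17, .plus 17 17 1, .load 22 17, .plus 17 17 1, .load 23 17,
      .plus 15 15 24, .plus 23 23 24, .const 16 1,
      .ifLt 24 4 .skip (.block [.plus 16 24 1, .plus 16 16 1, .minus 16 16 4])])

/-- Replaces a table, in place, by the list of the positions of its accepted entries. -/
def compact : Cmd :=
  .block [.copy 18 14, .copy 25 14, .plus 19 14 13,
    .whileLt 25 19 (.block [.load 26 25, .test 26 26,
      .ifLt 0 26 (.block [.store 18 16, .plus 18 18 1]) .skip, .plus 16 16 1, .plus 25 25 1])]

/-- Chooses the entry of the variable itself: its own block, or the entry of one of the parts if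
there is nothing outside that part. -/
def choose : Cmd :=
  .ifLt 14 18 (.block [.copy 8 6, .const 9 0])
    (.ifLt 0 20
      (.ifLt 0 22 (.block [.copy 8 6, .const 9 0]) (.block [.copy 8 20, .copy 9 21]))
      (.block [.copy 8 22, .copy 9 23]))

/-- Writes the block at address `reg 6` and moves `reg 6` to the next block. -/
def writeBlock : Cmd :=
  .block [.store 6 14, .plus 6 6 1, .store 6 18, .plus 6 6 1, .store 6 20, .plus 6 6 1,
    .store 6 21, .plus 6 6 1, .store 6 22, .plus 6 6 1, .store 6 23, .plus 6 6 1,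
    .store 6 15, .plus 6 6 1, .store 6 8, .plus 6 6 1, .store 6 9, .plus 6 6 1]

/-- One round of the preprocessing: reads the rule and the table of a variable, and writes its
block. -/
def processVariable : Cmd := .block [readRule, combine, compact, choose, writeBlock]

/-- The preprocessing of a representation whose records stand from address `e + 1` on and whose
first free address is in cell `e`. At the end, cell `0` holds the address behind the blocks, where
the entry of the start variable is the initial stack of the enumeration. -/
def prepare (e : ℕ) : Cmd :=
  .block [.const 1 1, .load 3 0, .load 4 1, .const 5 e, .load 2 5, .plus 5 5 1, .copy 6 2,
    .plus 7 3 3, .plus 7 7 7, .plus 7 7 7, .plus 7 7 3, .plus 7 7 2,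
    .whileLt 6 7 processVariable,
    .store 0 7, .minus 6 6 1, .load 9 6, .minus 6 6 1, .load 8 6, .store 7 8, .plus 7 7 1,
    .store 7 9]

/-! ### Execution of the parts of the preprocessing -/

section Machine

variable {w : ℕ} {acc : ℤ → Bool} (s : MachineState)

theorem runs_readRule {R : ℕ} (h1 : s.reg 1 = 1) (h5 : s.reg 5 = R) (hR : R + 5 < 2 ^ w) :
    Runs w acc readRule s 11 fun s' => s'.mem = s.mem ∧ s'.reg 5 = R + 5 ∧
      s'.reg 10 = s.mem R % 2 ^ w ∧ s'.reg 11 = s.mem (R + 1) % 2 ^ w ∧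
      s'.reg 12 = s.mem (R + 2) % 2 ^ w ∧ s'.reg 13 = s.mem (R + 3) % 2 ^ w ∧
      s'.reg 14 = s.mem (R + 4) % 2 ^ w ∧ ∀ r < 8, r ≠ 5 → s'.reg r = s.reg r := by
  refine Runs.load (s.mem R % 2 ^ w) (by rw [h5]) ?_
  refine Runs.plusEq (R + 1) (by simp [h1, h5]) (by omega) ?_
  refine Runs.load (s.mem (R + 1) % 2 ^ w) (by simp) ?_
  refine Runs.plusEq (R + 2) (by simp [h1]) (by omega) ?_
  refine Runs.load (s.mem (R + 2) % 2 ^ w) (by simp) ?_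
  refine Runs.plusEq (R + 3) (by simp [h1]) (by omega) ?_
  refine Runs.load (s.mem (R + 3) % 2 ^ w) (by simp) ?_
  refine Runs.plusEq (R + 4) (by simp [h1]) (by omega) ?_
  refine Runs.load (s.mem (R + 4) % 2 ^ w) (by simp) ?_
  refine Runs.plusEq (R + 5) (by simp [h1]) (by omega) ?_
  refine Runs.nil ⟨by simp, by simp, by simp, by simp, by simp, by simp, by simp, ?_⟩
  intro r hr hr5
  have : r ≠ 14 ∧ r ≠ 13 ∧ r ≠ 12 ∧ r ≠ 11 ∧ r ≠ 10 := by omega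
  simp [this, hr5]

theorem runs_combine_letter (h1 : s.reg 1 = 1) (h10 : s.reg 10 = 0) (hw : 1 < 2 ^ w) :
    Runs w acc combine s 40 fun s' => s'.mem = s.mem ∧ s'.reg 15 = 1 ∧ s'.reg 16 = 1 ∧
      s'.reg 20 = 0 ∧ s'.reg 21 = 0 ∧ s'.reg 22 = 0 ∧ s'.reg 23 = 0 ∧
      ∀ r < 15, s'.reg r = s.reg r := by
  refine Runs.mono (T := 8) (Runs.ifTrue (by omega) ?_) (by omega) fun _ h => h
  refine Runs.constEq hw ?_
  refine Runs.constEq hw ?_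
  refine Runs.constEq (by omega) ?_
  refine Runs.constEq (by omega) ?_
  refine Runs.constEq (by omega) ?_
  refine Runs.constEq (by omega) ?_
  refine Runs.nil ⟨by simp, by simp, by simp, by simp, by simp, by simp, by simp, ?_⟩
  intro r hr
  have : r ≠ 23 ∧ r ≠ 22 ∧ r ≠ 21 ∧ r ≠ 20 ∧ r ≠ 16 ∧ r ≠ 15 := by omega
  simp [this]

theorem runs_combine_pair {F l r m n a₁ a₂ a₃ b₁ b₂ b₃ : ℕ} (h1 : s.reg 1 = 1)
    (h2 : s.reg 2 = F) (h4 : s.reg 4 = m) (h10 : s.reg 10 = 1) (h11 : s.reg 11 = l)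
    (h12 : s.reg 12 = r) (hl : l < n) (hr : r < n) (hw : F + 9 * n + 8 < 2 ^ w)
    (ha₁ : s.mem (F + 9 * l + 6) % 2 ^ w = a₁) (ha₂ : s.mem (F + 9 * l + 7) % 2 ^ w = a₂)
    (ha₃ : s.mem (F + 9 * l + 8) % 2 ^ w = a₃) (hb₁ : s.mem (F + 9 * r + 6) % 2 ^ w = b₁)
    (hb₂ : s.mem (F + 9 * r + 7) % 2 ^ w = b₂) (hb₃ : s.mem (F + 9 * r + 8) % 2 ^ w = b₃) :
    Runs w acc combine s 40 fun s' => s'.mem = s.mem ∧ s'.reg 15 = (b₁ + a₁) % 2 ^ w ∧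
      (a₁ < m → s'.reg 16 = 1) ∧ (m ≤ a₁ → a₁ + 2 < 2 ^ w → s'.reg 16 = a₁ - m + 2) ∧
      s'.reg 16 < 2 ^ w ∧ s'.reg 20 = a₂ ∧ s'.reg 21 = a₃ ∧ s'.reg 22 = b₂ ∧
      s'.reg 23 = (b₃ + a₁) % 2 ^ w ∧ ∀ r < 15, s'.reg r = s.reg r := by
  have h1w : 1 < 2 ^ w := by omega
  refine Runs.mono (T := 35) (Runs.ifFalse (by omega) ?_) (by omega) fun _ h => h
  refine Runs.plusEq (2 * l) (by rw [h11]; omega) (by omega) ?_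
  refine Runs.plusEq (4 * l) (by simp; omega) (by omega) ?_
  refine Runs.plusEq (8 * l) (by simp; omega) (by omega) ?_
  refine Runs.plusEq (9 * l) (by simp [h11]; omega) (by omega) ?_
  refine Runs.plusEq (F + 9 * l) (by simp [h2]; omega) (by omega) ?_
  refine Runs.constEq (by omega) ?_
  refine Runs.plusEq (F + 9 * l + 6) (by simp) (by omega) ?_
  refine Runs.load a₁ (by simp [ha₁]) ?_
  refine Runs.plusEq (F + 9 * l + 7) (by simp [h1]) (by omega) ?_
  refine Runs.load a₂ (by simp [ha₂]) ?_
  refine Runs.plusEq (F + 9 * l + 8) (by simp [h1]) (by omega) ?_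
  refine Runs.load a₃ (by simp [ha₃]) ?_
  refine Runs.plusEq (2 * r) (by simp [h12]; omega) (by omega) ?_
  refine Runs.plusEq (4 * r) (by simp; omega) (by omega) ?_
  refine Runs.plusEq (8 * r) (by simp; omega) (by omega) ?_
  refine Runs.plusEq (9 * r) (by simp [h12]; omega) (by omega) ?_
  refine Runs.plusEq (F + 9 * r) (by simp [h2]; omega) (by omega) ?_
  refine Runs.plusEq (F + 9 * r + 6) (by simp) (by omega) ?_
  refine Runs.load b₁ (by simp [hb₁]) ?_
  refine Runs.plusEq (F + 9 * r + 7) (by simp [h1]) (by omega) ?_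
  refine Runs.load b₂ (by simp [hb₂]) ?_
  refine Runs.plusEq (F + 9 * r + 8) (by simp [h1]) (by omega) ?_
  refine Runs.load b₃ (by simp [hb₃]) ?_
  refine Runs.plus ((b₁ + a₁) % 2 ^ w) (by simp) ?_
  refine Runs.plus ((b₃ + a₁) % 2 ^ w) (by simp) ?_
  refine Runs.constEq h1w ?_
  have hreg : ∀ i < 15, i ≠ 24 ∧ i ≠ 23 ∧ i ≠ 22 ∧ i ≠ 21 ∧ i ≠ 20 ∧ i ≠ 18 ∧ i ≠ 17 ∧ i ≠ 16 ∧
      i ≠ 15 := by omega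
  by_cases hlt : a₁ < m
  · refine Runs.cons (T := 6) (T' := 2) (Runs.ifTrue (by simpa [h4] using hlt)
      (Runs.skip (Runs.nil ?_)))
    refine ⟨by simp, by simp, by simp, by omega, by simpa using h1w, by simp, by simp, by simp,
      by simp, fun i hi => ?_⟩
    simp [hreg i hi]
  · refine Runs.cons (T := 6) (T' := 2) (Runs.ifFalse (by simpa [h4] using hlt) ?_)
    refine Runs.plus ((a₁ + 1) % 2 ^ w) (by simp [h1]) ?_
    refine Runs.plus ((a₁ + 2) % 2 ^ w) (by simp [h1]) ?_
    refine Runs.minus (((a₁ + 2) % 2 ^ w + (2 ^ w - m % 2 ^ w)) % 2 ^ w) (by simp [h4]) ?_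
    refine Runs.nil (Runs.nil ?_)
    refine ⟨by simp, by simp, fun h => absurd h hlt, fun h hw => ?_, ?_, by simp, by simp,
      by simp, by simp, fun i hi => ?_⟩
    · simp only [MachineState.set_reg, if_true]
      rw [Nat.mod_eq_of_lt hw, minus_word (by omega) hw]
      omega
    · simp only [MachineState.set_reg, if_true]
      exact Nat.mod_lt _ (by omega)
    · simp [hreg i hi]

/-- The list of accepted positions never overtakes the cell that is read next. -/
theorem runs_compact {t n p : ℕ} (h0 : s.reg 0 = 0) (h1 : s.reg 1 = 1) (h14 : s.reg 14 = t)
    (h13 : s.reg 13 = n) (h16 : s.reg 16 = p) (hp : p < 2 ^ w) (hw : t + n < 2 ^ w) :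
    Runs w acc compact s (10 * n + 5) fun s' =>
      ∃ L, L = ((List.range n).filter fun k => acc (ofWord w (s.mem (t + k) % 2 ^ w))).map
          (fun k => (p + k) % 2 ^ w) ∧
        s'.reg 18 = t + L.length ∧ (∀ k (h : k < L.length), s'.mem (t + k) = L[k]) ∧
        (∀ a, a < t ∨ t + n ≤ a → s'.mem a = s.mem a) ∧
        ∀ r, r < 16 ∨ r = 20 ∨ r = 21 ∨ r = 22 ∨ r = 23 → s'.reg r = s.reg r := by
  let L : ℕ → List ℕ := fun i =>
    ((List.range i).filter fun k => acc (ofWord w (s.mem (t + k) % 2 ^ w))).map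
      (fun k => (p + k) % 2 ^ w)
  have hLlen : ∀ i, (L i).length ≤ i := fun i => by
    simp only [L, List.length_map]
    exact (List.length_filter_le _ _).trans (by simp)
  refine Runs.copyEq t h14 (by omega) ?_
  refine Runs.copyEq t (by simp [h14]) (by omega) ?_
  refine Runs.plusEq (t + n) (by simp [h14, h13]) hw ?_
  refine Runs.cons (T := 10 * n + 1) (T' := 1) ?_
  refine (Runs.whileCount n (fun i s' => s'.reg 25 = t + i ∧ s'.reg 19 = t + n ∧
    s'.reg 16 = (p + i) % 2 ^ w ∧ s'.reg 18 = t + (L i).length ∧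
    (∀ k (h : k < (L i).length), s'.mem (t + k) = (L i)[k]) ∧
    (∀ a, a < t ∨ t + i ≤ a → s'.mem a = s.mem a) ∧
    ∀ r, r < 16 ∨ r = 20 ∨ r = 21 ∨ r = 22 ∨ r = 23 → s'.reg r = s.reg r)
    (fun _ => 9) (fun i => 10 * (n - i) + 1) ?_ ?_ ?_ ?_ ?_).mono le_rfl ?_
  · rintro i s' hi ⟨i25, i19, i16, i18, iL, im, ir⟩
    have i0 := (ir 0 (by omega)).trans h0
    have i1 := (ir 1 (by omega)).trans h1
    have hreg : ∀ r, r < 16 ∨ r = 20 ∨ r = 21 ∨ r = 22 ∨ r = 23 →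
        r ≠ 16 ∧ r ≠ 18 ∧ r ≠ 25 ∧ r ≠ 26 := by omega
    have hle := hLlen i
    have hsucc : (p + i) % 2 ^ w + 1 = (p + i) % 2 ^ w + 1 % 2 ^ w := by
      rw [Nat.mod_eq_of_lt (show 1 < 2 ^ w by omega)]
    have hnext : ((p + i) % 2 ^ w + 1) % 2 ^ w = (p + (i + 1)) % 2 ^ w := by
      rw [hsucc, ← Nat.add_mod, add_assoc]
    refine ⟨by omega, ?_⟩
    refine Runs.load (s.mem (t + i) % 2 ^ w) (by rw [i25, im _ (by omega)]) ?_
    by_cases ha : acc (ofWord w (s.mem (t + i) % 2 ^ w)) = true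
    · have hL : L (i + 1) = L i ++ [(p + i) % 2 ^ w] := by
        simp [L, List.range_succ, List.filter_append, ha]
      refine Runs.test 1 (by
        rw [MachineState.set_reg, if_pos rfl, if_pos ha, Nat.mod_eq_of_lt (by omega)]) ?_
      refine Runs.cons (T := 4) (T' := 3) (Runs.ifTrue (by simp [i0]) ?_)
      refine Runs.store (t + (L i).length) ((p + i) % 2 ^ w) (by simp [i18]) (by simp [i16]) ?_
      refine Runs.plusEq (t + (L i).length + 1) (by simp [i18, i1]) (by omega) ?_
      refine Runs.nil ?_
      refine Runs.plus ((p + (i + 1)) % 2 ^ w) (by simp [i16, i1, hnext]) ?_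
      refine Runs.plusEq (t + (i + 1)) (by simp [i25, i1]; omega) (by omega) ?_
      refine Runs.nil ⟨by simp, by simp [i19], by simp, by simp [hL]; omega, ?_, ?_, ?_⟩
      · intro k hk
        simp only [MachineState.set_mem, MachineState.put_mem]
        simp only [hL, List.length_append, List.length_singleton] at hk
        simp only [hL, List.getElem_append]
        split_ifs with h h' h'
        · omega
        · simp
        · rw [iL k h']
        · omega
      · intro a ha
        simp only [MachineState.set_mem, MachineState.put_mem]
        rw [if_neg (by omega), im a (by omega)]
      · intro r hr
        simp [hreg r hr, ir r hr]
    · have hL : L (i + 1) = L i := by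
        simp [L, List.range_succ, List.filter_append, ha]
      refine Runs.test 0 (by simp [ha]) ?_
      refine Runs.cons (T := 4) (T' := 3) (Runs.ifFalse (by simp [i0]) (Runs.skip ?_))
      refine Runs.plus ((p + (i + 1)) % 2 ^ w) (by simp [i16, i1, hnext]) ?_
      refine Runs.plusEq (t + (i + 1)) (by simp [i25, i1]; omega) (by omega) ?_
      refine Runs.nil ⟨by simp, by simp [i19], by simp, by simp [hL, i18], ?_, ?_, ?_⟩
      · intro k hk
        simp only [hL] at hk ⊢
        simpa using iL k hk
      · intro a ha
        simpa using im a (by omega)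
      · intro r hr
        simp [hreg r hr, ir r hr]
  · rintro s' ⟨i25, i19, -⟩
    omega
  · intro i hi; omega
  · simp
  · refine ⟨by simp, by simp, by simp [h16, Nat.mod_eq_of_lt hp], by simp [L], by simp [L],
      by simp, fun r hr => ?_⟩
    have : r ≠ 19 ∧ r ≠ 18 ∧ r ≠ 25 := by omega
    simp [this]
  · rintro s' ⟨-, -, -, i18, iL, im, ir⟩
    exact Runs.nil ⟨L n, rfl, i18, iL, im, ir⟩

theorem runs_choose {a : ℕ} (h0 : s.reg 0 = 0) (h6 : s.reg 6 = a) (ha : a < 2 ^ w)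
    (h20 : s.reg 20 < 2 ^ w) (h21 : s.reg 21 < 2 ^ w) (h22 : s.reg 22 < 2 ^ w)
    (h23 : s.reg 23 < 2 ^ w) :
    Runs w acc choose s 6 fun s' => s'.mem = s.mem ∧
      (s.reg 14 < s.reg 18 ∨ 0 < s.reg 20 ∧ 0 < s.reg 22 → s'.reg 8 = a ∧ s'.reg 9 = 0) ∧
      (¬ s.reg 14 < s.reg 18 → 0 < s.reg 20 → s.reg 22 = 0 →
        s'.reg 8 = s.reg 20 ∧ s'.reg 9 = s.reg 21) ∧
      (¬ s.reg 14 < s.reg 18 → s.reg 20 = 0 → s'.reg 8 = s.reg 22 ∧ s'.reg 9 = s.reg 23) ∧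
      ∀ r, r ≠ 8 → r ≠ 9 → s'.reg r = s.reg r := by
  have hw : 0 < 2 ^ w := by omega
  by_cases hc : s.reg 14 < s.reg 18
  · refine Runs.ifTrue hc ?_
    refine Runs.copyEq a h6 ha ?_
    refine Runs.constEq hw ?_
    exact Runs.nil ⟨by simp, by simp, by simp [hc], by simp [hc], by simp +contextual⟩
  refine Runs.ifFalse hc ?_
  by_cases hl : 0 < s.reg 20
  · refine Runs.ifTrue (by omega) ?_
    by_cases hr : 0 < s.reg 22
    · refine Runs.ifTrue (by omega) ?_
      refine Runs.copyEq a h6 ha ?_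
      refine Runs.constEq hw ?_
      exact Runs.nil ⟨by simp, by simp, by omega, by omega, by simp +contextual⟩
    · refine Runs.ifFalse (by omega) ?_
      refine Runs.copyEq _ rfl h20 ?_
      refine Runs.copyEq (s.reg 21) (by simp) h21 ?_
      exact Runs.nil ⟨by simp, by omega, by simp, by omega, by simp +contextual⟩
  · refine Runs.ifFalse (by omega) ?_
    refine Runs.copyEq _ rfl h22 ?_
    refine Runs.copyEq (s.reg 23) (by simp) h23 ?_
    exact Runs.mono (T := 1) (Runs.nil ⟨by simp, by omega, by omega, by simp,
      by simp +contextual⟩) (by omega) fun _ h => h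

theorem runs_writeBlock {B : ℕ} (h1 : s.reg 1 = 1) (h6 : s.reg 6 = B) (hB : B + 9 < 2 ^ w) :
    Runs w acc writeBlock s 19 fun s' => s'.mem B = s.reg 14 ∧ s'.mem (B + 1) = s.reg 18 ∧
      s'.mem (B + 2) = s.reg 20 ∧ s'.mem (B + 3) = s.reg 21 ∧ s'.mem (B + 4) = s.reg 22 ∧
      s'.mem (B + 5) = s.reg 23 ∧ s'.mem (B + 6) = s.reg 15 ∧ s'.mem (B + 7) = s.reg 8 ∧
      s'.mem (B + 8) = s.reg 9 ∧ (∀ a, a < B ∨ B + 9 ≤ a → s'.mem a = s.mem a) ∧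
      s'.reg 6 = B + 9 ∧ ∀ r, r ≠ 6 → s'.reg r = s.reg r := by
  refine Runs.store B (s.reg 14) h6 rfl ?_
  refine Runs.plusEq (B + 1) (by simp [h1, h6]) (by omega) ?_
  refine Runs.store (B + 1) (s.reg 18) (by simp) (by simp) ?_
  refine Runs.plusEq (B + 2) (by simp [h1]) (by omega) ?_
  refine Runs.store (B + 2) (s.reg 20) (by simp) (by simp) ?_
  refine Runs.plusEq (B + 3) (by simp [h1]) (by omega) ?_
  refine Runs.store (B + 3) (s.reg 21) (by simp) (by simp) ?_
  refine Runs.plusEq (B + 4) (by simp [h1]) (by omega) ?_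
  refine Runs.store (B + 4) (s.reg 22) (by simp) (by simp) ?_
  refine Runs.plusEq (B + 5) (by simp [h1]) (by omega) ?_
  refine Runs.store (B + 5) (s.reg 23) (by simp) (by simp) ?_
  refine Runs.plusEq (B + 6) (by simp [h1]) (by omega) ?_
  refine Runs.store (B + 6) (s.reg 15) (by simp) (by simp) ?_
  refine Runs.plusEq (B + 7) (by simp [h1]) (by omega) ?_
  refine Runs.store (B + 7) (s.reg 8) (by simp) (by simp) ?_
  refine Runs.plusEq (B + 8) (by simp [h1]) (by omega) ?_
  refine Runs.store (B + 8) (s.reg 9) (by simp) (by simp) ?_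
  refine Runs.plusEq (B + 9) (by simp [h1]) (by omega) ?_
  refine Runs.nil ?_
  simp only [MachineState.set_mem, MachineState.put_mem]
  refine ⟨by simp, by simp, by simp, by simp, by simp, by simp, by simp, by simp, by simp, ?_,
    by simp, fun r hr => by simp [hr]⟩
  intro a ha
  have : a ≠ B ∧ a ≠ B + 1 ∧ a ≠ B + 2 ∧ a ≠ B + 3 ∧ a ≠ B + 4 ∧ a ≠ B + 5 ∧ a ≠ B + 6 ∧
    a ≠ B + 7 ∧ a ≠ B + 8 := by omega
  simp [this]

end Machine

/-! ### Correctness of the preprocessing -/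

section Entries

variable {α : Type} {d : ℕ} {σ π : Fin d → α → ℤ} {acc : ℤ → Bool} {G : SLP α} {P : List α}
  {F len len' bound bound' a o w : ℕ} {O : Finset ℕ}

theorem Entry.mono (h : Entry σ π acc G P F O len bound a o) (hl : len ≤ len')
    (hb : bound ≤ bound') : Entry σ π acc G P F O len' bound' a o := by
  rcases h with h | ⟨j, hj, ha, hg, ho, h⟩
  · exact .inl h
  · exact .inr ⟨j, by omega, ha, hg, by omega, h⟩

theorem Entry.shift (h : Entry σ π acc G P F O len bound a o) (c : ℕ) :
    Entry σ π acc G P F (O.image (c + ·)) (c + len) bound a (o + c) := by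
  rcases h with ⟨rfl, ha⟩ | ⟨j, hj, ha, hg, ho, rfl, h⟩
  · exact .inl ⟨by simp, ha⟩
  · refine .inr ⟨j, hj, ha, hg, by omega, ?_, h⟩
    rw [Finset.image_image]
    refine Finset.image_congr fun x _ => ?_
    simp only [Function.comp_apply]
    omega

/-- Entries consist of words, up to the shift of an empty set. -/
theorem Entry.mod (h : Entry σ π acc G P F O len bound a o) (hl : len < 2 ^ w)
    (hF : F + 9 * G.size < 2 ^ w) :
    Entry σ π acc G P F O len bound (a % 2 ^ w) (o % 2 ^ w) := by
  rcases h with ⟨hO, rfl⟩ | ⟨j, hj, ha, hg, ho, h⟩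
  · exact .inl ⟨hO, Nat.zero_mod _⟩
  · refine .inr ⟨j, hj, ?_, hg, ?_, ?_⟩
    · rw [ha, Nat.mod_eq_of_lt (by omega)]
    · rwa [Nat.mod_eq_of_lt (by omega)]
    · rwa [Nat.mod_eq_of_lt (by omega)]

theorem Entry.eq_zero_iff (h : Entry σ π acc G P F O len bound a o) (hP : 1 ≤ P.length)
    (hF : 0 < F) : a = 0 ↔ O = ∅ := by
  have h' := h.card_eq_zero hP
  rcases h with ⟨h1, h2⟩ | ⟨j, -, ha, -⟩
  · simp [h1, h2]
  · constructor
    · omega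
    · intro hO; rcases h' with h' | h'
      · exact h'
      · exact absurd (Finset.card_eq_zero.2 hO) h'

theorem Entry.self {j : Fin G.size} (hg : G.Good j)
    (h : G.ownList σ π acc P j ≠ [] ∨ (G.leftOcc σ π acc P j).Nonempty ∧
      (G.rightOcc σ π acc P j).Nonempty) :
    Entry σ π acc G P F (G.occAt σ π acc P j) (G.val j).length (j + 1) (F + 9 * j) 0 :=
  .inr ⟨j, by omega, rfl, hg, by omega, by simp, h⟩

end Entries

/-- The part of the memory contents that the preprocessing relies on: the header, the records from
address `e + 1` on, and tables which decide the criterion for the variables that occur in the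
text. -/
structure Ready {α : Type} {d : ℕ} (G : SLP α) (P : List α) (σ π : Fin d → α → ℤ)
    (acc : ℤ → Bool) (w e : ℕ) (mem : ℕ → ℕ) : Prop where
  numVars : mem 0 = G.size
  patLength : mem 1 = P.length
  free : mem e = e + 1 + 5 * G.size + G.totalWindows P.length
  rules : G.StoredAt P.length mem (e + 1)
  tables : ∀ j : Fin G.size, G.Good j → ∀ k < G.windows P.length j,
    acc (ofWord w (mem (e + 1 + 5 * G.size + G.windowsBefore P.length j + k) % 2 ^ w)) =
      acc (conv σ π (G.seam P.length j) P (k + 1))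

/-- The state before variable number `j` is processed: its table and those behind it are as they
were in the memory `M`, and the variables before it have their blocks. -/
structure PrepInv {α : Type} {d : ℕ} (G : SLP α) (P : List α) (σ π : Fin d → α → ℤ)
    (acc : ℤ → Bool) (e F : ℕ) (M : ℕ → ℕ) (j : ℕ) (s : MachineState) : Prop where
  r0 : s.reg 0 = 0
  r1 : s.reg 1 = 1
  r2 : s.reg 2 = F
  r4 : s.reg 4 = P.length
  r5 : s.reg 5 = e + 1 + 5 * j
  r6 : s.reg 6 = F + 9 * j
  r7 : s.reg 7 = F + 9 * G.size
  low : ∀ a < e + 1 + 5 * G.size, s.mem a = M a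
  tab : ∀ a, e + 1 + 5 * G.size + G.windowsBefore P.length j ≤ a → a < F → s.mem a = M a
  blocks : ∀ i : Fin G.size, i.val < j → G.Good i →
    Block σ π acc G P F i (e + 1 + 5 * G.size + G.windowsBefore P.length i) s.mem

section Variable

variable {α : Type} {d : ℕ} {σ π : Fin d → α → ℤ} {acc : ℤ → Bool} {G : SLP α} {P : List α}
  {w e F : ℕ} {M : ℕ → ℕ}

theorem SLP.Good.length_le {j : Fin G.size} (h : G.Good j) :
    (G.val j).length ≤ G.text.length := List.IsInfix.length_le h

/-- The branch on the rule, for both kinds of rules. -/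
theorem runs_combine (hP : 1 ≤ P.length) (hw : F + 9 * G.size + 8 < 2 ^ w)
    (hN : G.text.length + 2 < 2 ^ w) (j : Fin G.size)
    (s : MachineState) (h1 : s.reg 1 = 1) (h2 : s.reg 2 = F) (h4 : s.reg 4 = P.length)
    (hr : match G.rule j with
      | .letter _ => s.reg 10 = 0
      | .pair l r => s.reg 10 = 1 ∧ s.reg 11 = l ∧ s.reg 12 = r)
    (hb : ∀ i : Fin G.size, i.val < j → G.Good i → ∃ t, Block σ π acc G P F i t s.mem) :
    Runs w acc combine s 40 fun s' => s'.mem = s.mem ∧ s'.reg 16 < 2 ^ w ∧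
      (∀ r < 15, s'.reg r = s.reg r) ∧
      (s'.reg 20 < 2 ^ w ∧ s'.reg 21 < 2 ^ w ∧ s'.reg 22 < 2 ^ w ∧ s'.reg 23 < 2 ^ w) ∧
      (G.Good j → s'.reg 15 = (G.val j).length ∧ s'.reg 16 = G.firstPos P.length j ∧
        Entry σ π acc G P F (G.leftOcc σ π acc P j) (G.val j).length j (s'.reg 20) (s'.reg 21) ∧
        Entry σ π acc G P F (G.rightOcc σ π acc P j) (G.val j).length j
          (s'.reg 22) (s'.reg 23)) := by
  have hpos : 0 < 2 ^ w := by omega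
  cases h : G.rule j with
  | letter a =>
    simp only [h] at hr
    refine (runs_combine_letter s h1 hr (by omega)).mono le_rfl ?_
    rintro s' ⟨hm, h15, h16, h20, h21, h22, h23, hreg⟩
    refine ⟨hm, by omega, hreg, by omega, fun _ => ⟨?_, ?_, .inl ⟨?_, h20⟩, .inl ⟨?_, h22⟩⟩⟩
    · simp [h15, G.val_letter h]
    · simp [h16, SLP.firstPos, h]
    · simp [SLP.leftOcc, h]
    · simp [SLP.rightOcc, h]
  | pair l r =>
    simp only [h] at hr
    obtain ⟨h10, h11, h12⟩ := hr
    have hl := l.2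
    have hr := r.2
    have hj := j.2
    refine (runs_combine_pair (n := G.size) s h1 h2 h4 h10 h11 h12 (by omega) (by omega) (by omega)
      rfl rfl rfl rfl rfl rfl).mono le_rfl ?_
    rintro s' ⟨hmem, h15, h16, h16', h16w, h20, h21, h22, h23, hreg⟩
    refine ⟨hmem, h16w, hreg, ⟨?_, ?_, ?_, ?_⟩, fun hg => ?_⟩
    · rw [h20]; exact Nat.mod_lt _ hpos
    · rw [h21]; exact Nat.mod_lt _ hpos
    · rw [h22]; exact Nat.mod_lt _ hpos
    · rw [h23]; exact Nat.mod_lt _ hpos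
    have hlen : (G.val j).length = (G.val (G.child l)).length + (G.val (G.child r)).length := by
      rw [G.val_pair h, List.length_append]
    have hjN := hg.length_le
    obtain ⟨t, hL⟩ := hb (G.child l) hl (hg.left h)
    obtain ⟨t', hR⟩ := hb (G.child r) hr (hg.right h)
    have a1 : s.mem (F + 9 * l + 6) % 2 ^ w = (G.val (G.child l)).length := by
      rw [show s.mem (F + 9 * l + 6) = _ from hL.length, Nat.mod_eq_of_lt (by omega)]
    have b1 : s.mem (F + 9 * r + 6) % 2 ^ w = (G.val (G.child r)).length := by
      rw [show s.mem (F + 9 * r + 6) = _ from hR.length, Nat.mod_eq_of_lt (by omega)]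
    rw [a1] at h15 h16 h16' h23
    rw [b1] at h15
    refine ⟨?_, ?_, ?_, ?_⟩
    · rw [h15, Nat.mod_eq_of_lt (by omega)]; omega
    · simp only [SLP.firstPos, h]
      by_cases hc : (G.val (G.child l)).length < P.length
      · rw [h16 hc]; omega
      · rw [h16' (by omega) (by omega)]; omega
    · simp only [SLP.leftOcc, h]
      rw [h20, h21]
      exact (hL.self.mod (by omega) (by omega)).mono (by omega) hl
    · simp only [SLP.rightOcc, h]
      rw [h22, h23, Nat.mod_add_mod]
      exact ((hR.self.shift _).mod (by omega) (by omega)).mono (by omega) hr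

/-- If a variable has no own occurrences and none in one of its parts, then the entry of the other
part represents all its occurrences. -/
theorem entry_choose (hP : 1 ≤ P.length) (hF : 0 < F) {j : Fin G.size} (hg : G.Good j)
    {b₁ b₂ l₁ l₂ r₁ r₂ x y : ℕ}
    (hL : Entry σ π acc G P F (G.leftOcc σ π acc P j) (G.val j).length j l₁ l₂)
    (hR : Entry σ π acc G P F (G.rightOcc σ π acc P j) (G.val j).length j r₁ r₂)
    (hb : b₂ = b₁ + (G.ownList σ π acc P j).length)
    (h₁ : b₁ < b₂ ∨ 0 < l₁ ∧ 0 < r₁ → x = F + 9 * j ∧ y = 0)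
    (h₂ : ¬ b₁ < b₂ → 0 < l₁ → r₁ = 0 → x = l₁ ∧ y = l₂)
    (h₃ : ¬ b₁ < b₂ → l₁ = 0 → x = r₁ ∧ y = r₂) :
    Entry σ π acc G P F (G.occAt σ π acc P j) (G.val j).length (j + 1) x y := by
  have hl := hL.eq_zero_iff hP hF
  have hr := hR.eq_zero_iff hP hF
  have hown : b₁ < b₂ ↔ G.ownList σ π acc P j ≠ [] := by
    rw [← List.length_pos_iff]; omega
  by_cases hc : b₁ < b₂ ∨ 0 < l₁ ∧ 0 < r₁
  · obtain ⟨rfl, rfl⟩ := h₁ hc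
    refine Entry.self hg ?_
    rw [hown] at hc
    refine hc.imp id fun h => ?_
    rw [Finset.nonempty_iff_ne_empty, Finset.nonempty_iff_ne_empty, Ne, Ne, ← hl, ← hr]
    omega
  · have hb : ¬ b₁ < b₂ := fun h => hc (.inl h)
    have hnil : G.ownList σ π acc P j = [] := by_contra fun h => hb (hown.2 h)
    by_cases hl0 : l₁ = 0
    · obtain ⟨rfl, rfl⟩ := h₃ hb hl0
      have : G.occAt σ π acc P j = G.rightOcc σ π acc P j := by
        ext z; rw [G.mem_occAt σ π acc P hP, hnil, hl.1 hl0]; simp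
      rw [this]
      exact hR.mono le_rfl (by omega)
    · obtain ⟨rfl, rfl⟩ := h₂ hb (by omega) (by omega)
      have : G.occAt σ π acc P j = G.leftOcc σ π acc P j := by
        ext z; rw [G.mem_occAt σ π acc P hP, hnil, hr.1 (by omega)]; simp
      rw [this]
      exact hL.mono le_rfl (by omega)

theorem runs_processVariable (hP : 1 ≤ P.length) (hm : P.length ≤ G.text.length)
    (hM : Ready G P σ π acc w e M)
    (hF : F = e + 1 + 5 * G.size + G.totalWindows P.length) (hw : F + 9 * G.size + 9 < 2 ^ w)
    (hN : G.text.length + 2 < 2 ^ w) (j : Fin G.size) (s : MachineState)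
    (hs : PrepInv G P σ π acc e F M j s) :
    Runs w acc processVariable s (10 * G.windows P.length j + 82)
      (PrepInv G P σ π acc e F M (j + 1)) := by
  have hj := j.2
  have hwj := G.windowsBefore_le P.length j
  have hwin := G.ownList_length_le σ π acc P j
  have hsucc := G.windowsBefore_succ P.length j
  obtain ⟨hrule, hcnt, hadr⟩ := hM.rules j
  refine Runs.cons' (T' := 10 * G.windows P.length j + 71)
    (runs_readRule s hs.r1 hs.r5 (by omega)) (by omega) ?_
  rintro s₁ ⟨m₁, a5, a10, a11, a12, a13, a14, ar⟩
  rw [hs.low _ (by omega)] at a10 a11 a12 a13 a14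
  rw [hcnt, Nat.mod_eq_of_lt (by omega)] at a13
  rw [hadr, Nat.mod_eq_of_lt (by omega)] at a14
  refine Runs.cons' (T' := 10 * G.windows P.length j + 31)
    (runs_combine (σ := σ) (π := π) (F := F) hP (by omega) hN j s₁
      ((ar 1 (by decide) (by decide)).trans hs.r1)
      ((ar 2 (by decide) (by decide)).trans hs.r2) ((ar 4 (by decide) (by decide)).trans hs.r4)
      ?_ ?_) (by omega) ?_
  · cases h : G.rule j with
    | letter a =>
      simp only [h] at hrule ⊢
      rw [a10, hrule, Nat.zero_mod]
    | pair l r =>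
      simp only [h] at hrule ⊢
      have hl := l.2
      have hr := r.2
      rw [a10, a11, a12, hrule.1, hrule.2.1, hrule.2.2]
      exact ⟨Nat.mod_eq_of_lt (by omega), Nat.mod_eq_of_lt (by omega), Nat.mod_eq_of_lt (by omega)⟩
  · intro i hi hg
    rw [m₁]
    exact ⟨_, hs.blocks i hi hg⟩
  rintro s₂ ⟨m₂, b16, br, ⟨b20, b21, b22, b23⟩, bg⟩
  refine Runs.cons' (T' := 26) (runs_compact s₂
    ((br 0 (by decide)).trans ((ar 0 (by decide) (by decide)).trans hs.r0))
    ((br 1 (by decide)).trans ((ar 1 (by decide) (by decide)).trans hs.r1))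
    ((br 14 (by decide)).trans a14) ((br 13 (by decide)).trans a13) rfl b16 (by omega))
    (by omega) ?_
  rintro s₃ ⟨L, hL, c18, cL, cm, cr⟩
  refine Runs.cons' (T' := 20) (runs_choose s₃ (a := F + 9 * j)
    ((cr 0 (by decide)).trans ((br 0 (by decide)).trans ((ar 0 (by decide) (by decide)).trans hs.r0)))
    ((cr 6 (by decide)).trans ((br 6 (by decide)).trans ((ar 6 (by decide) (by decide)).trans hs.r6)))
    (by omega) (by rwa [cr 20 (by decide)]) (by rwa [cr 21 (by decide)])
    (by rwa [cr 22 (by decide)]) (by rwa [cr 23 (by decide)])) (by omega) ?_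
  rintro s₄ ⟨m₄, d1, d2, d3, dr⟩
  have z : ∀ r < 8, r ≠ 5 → s₄.reg r = s.reg r := fun r h h' =>
    (dr r (by omega) (by omega)).trans
      ((cr r (by omega)).trans ((br r (by omega)).trans (ar r h h')))
  refine Runs.cons' (T' := 1) (runs_writeBlock s₄ (B := F + 9 * j)
    ((z 1 (by decide) (by decide)).trans hs.r1) ((z 6 (by decide) (by decide)).trans hs.r6)
    (by omega)) (by omega) ?_
  rintro s₅ ⟨w0, w1, w2, w3, w4, w5, w6, w7, w8, wm, e6, er⟩
  have z' : ∀ r < 8, r ≠ 5 → r ≠ 6 → s₅.reg r = s.reg r := fun r h h' h'' =>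
    (er r h'').trans (z r h h')
  have hmem : ∀ a, a < F + 9 * j ∨ F + 9 * j + 9 ≤ a →
      a < e + 1 + 5 * G.size + G.windowsBefore P.length j ∨
        e + 1 + 5 * G.size + G.windowsBefore P.length j + G.windows P.length j ≤ a →
      s₅.mem a = s.mem a := by
    intro a h h'
    rw [wm a h, m₄, cm a h', m₂, m₁]
  refine Runs.nil ⟨?_, ?_, ?_, ?_, ?_, ?_, ?_, ?_, ?_, ?_⟩
  · exact (z' 0 (by decide) (by decide) (by decide)).trans hs.r0
  · exact (z' 1 (by decide) (by decide) (by decide)).trans hs.r1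
  · exact (z' 2 (by decide) (by decide) (by decide)).trans hs.r2
  · exact (z' 4 (by decide) (by decide) (by decide)).trans hs.r4
  · rw [er 5 (by decide), dr 5 (by decide) (by decide), cr 5 (by decide), br 5 (by decide), a5]
    omega
  · rw [e6]; omega
  · exact (z' 7 (by decide) (by decide) (by decide)).trans hs.r7
  · intro a ha
    rw [hmem a (by omega) (by omega), hs.low a ha]
  · intro a ha ha'
    rw [hmem a (by omega) (by omega), hs.tab a (by omega) ha']
  · intro i hi hg
    by_cases hij : i.val < j
    · have hmono := G.windowsBefore_mono P.length (show i.val + 1 ≤ j by omega)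
      rw [G.windowsBefore_succ] at hmono
      exact (hs.blocks i hij hg).congr (fun a h h' => hmem a (by omega) (by omega))
        fun a h h' => hmem a (by omega) (by omega)
    · obtain rfl : i = j := Fin.ext (by omega)
      obtain ⟨g15, g16, gL, gR⟩ := bg hg
      have hLo : L = G.ownList σ π acc P i := by
        rw [hL, SLP.ownList]
        have hf : (List.range (G.windows P.length i)).filter (fun k => acc (ofWord w
            (s₂.mem (e + 1 + 5 * G.size + G.windowsBefore P.length i + k) % 2 ^ w))) =
            (List.range (G.windows P.length i)).filter
              fun k => acc (conv σ π (G.seam P.length i) P (k + 1)) := by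
          refine List.filter_congr fun k hk => ?_
          rw [List.mem_range] at hk
          rw [m₂, m₁, hs.tab _ (by omega) (by omega), hM.tables i hg k hk]
        rw [hf]
        refine List.map_congr_left fun k hk => ?_
        have hk := List.mem_range.1 (List.mem_filter.1 hk).1
        have := G.firstPos_add_le P i hk
        have := hg.length_le
        rw [g16, Nat.mod_eq_of_lt (by omega)]
      have f14 : s₃.reg 14 = e + 1 + 5 * G.size + G.windowsBefore P.length i := by
        rw [cr 14 (by decide), br 14 (by decide), a14]
      have c20 := cr 20 (by decide)
      have c21 := cr 21 (by decide)
      have c22 := cr 22 (by decide)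
      have c23 := cr 23 (by decide)
      rw [← c20, ← c21] at gL
      rw [← c22, ← c23] at gR
      have gS := entry_choose (b₁ := s₃.reg 14) (b₂ := s₃.reg 18) hP (by omega) hg gL gR
        (by rw [c18, f14, hLo]) d1 d2 d3
      constructor
      · rw [w0, dr 14 (by decide) (by decide), f14]
      · rw [w1, dr 18 (by decide) (by decide), c18, hLo]
      · intro k hk
        rw [wm _ (by omega), m₄]
        subst hLo
        exact cL k hk
      · rw [w2, w3, dr 20 (by decide) (by decide), dr 21 (by decide) (by decide)]
        exact gL
      · rw [w4, w5, dr 22 (by decide) (by decide), dr 23 (by decide) (by decide)]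
        exact gR
      · rw [w6, dr 15 (by decide) (by decide), cr 15 (by decide), g15]
      · rw [w7, w8]
        exact gS

end Variable

/-! ### The whole preprocessing -/

section Prepare

variable {α : Type} {d : ℕ} {σ π : Fin d → α → ℤ} {acc : ℤ → Bool} {G : SLP α} {P : List α}
  {w e F : ℕ}

/-- The preprocessing builds the blocks and the initial stack, in linear time. -/
theorem runs_prepare (hP : 1 ≤ P.length) (hm : P.length ≤ G.text.length) (s : MachineState)
    (h0 : s.reg 0 = 0) (hM : Ready G P σ π acc w e s.mem)
    (hF : F = e + 1 + 5 * G.size + G.totalWindows P.length) (hw : F + 9 * G.size + 9 < 2 ^ w)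
    (hN : G.text.length + 2 < 2 ^ w) :
    Runs w acc (prepare e) s (83 * G.size + 10 * G.totalWindows P.length + 25) fun s' =>
      (∀ j, G.Good j → ∃ t, t + G.windows P.length j ≤ F ∧
        Block σ π acc G P F j t s'.mem) ∧
      s'.mem 0 = F + 9 * G.size ∧
      ∃ a o, s'.mem (F + 9 * G.size) = a ∧ s'.mem (F + 9 * G.size + 1) = o % 2 ^ w ∧
        Entry σ π acc G P F (occ σ π acc G.text P) G.text.length G.size a o := by
  have hn := G.size_pos
  have hfree := hM.free
  rw [← hF] at hfree
  refine Runs.constEq (by omega) ?_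
  refine Runs.loadEq G.size (by simp [h0, hM.numVars]) (by omega) ?_
  refine Runs.loadEq P.length (by simp [hM.patLength]) (by omega) ?_
  refine Runs.constEq (by omega) ?_
  refine Runs.loadEq F (by simp [hfree]) (by omega) ?_
  refine Runs.plusEq (e + 1) (by simp) (by omega) ?_
  refine Runs.copyEq F (by simp) (by omega) ?_
  refine Runs.plusEq (2 * G.size) (by simp; omega) (by omega) ?_
  refine Runs.plusEq (4 * G.size) (by simp; omega) (by omega) ?_
  refine Runs.plusEq (8 * G.size) (by simp; omega) (by omega) ?_
  refine Runs.plusEq (9 * G.size) (by simp; omega) (by omega) ?_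
  refine Runs.plusEq (F + 9 * G.size) (by simp; omega) (by omega) ?_
  refine Runs.cons' (T' := 9) (Runs.whileCount G.size (PrepInv G P σ π acc e F s.mem)
    (fun i => 10 * (G.windowsBefore P.length (i + 1) - G.windowsBefore P.length i) + 82)
    (fun i => 83 * (G.size - i) +
      10 * (G.totalWindows P.length - G.windowsBefore P.length i) + 1)
    ?_ ?_ ?_ ?_ ?_) ?_ ?_
  · intro i s' hi hs
    refine ⟨by rw [hs.r6, hs.r7]; omega, ?_⟩
    have := G.windowsBefore_succ P.length ⟨i, hi⟩
    simp only at this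
    rw [this, Nat.add_sub_cancel_left]
    exact runs_processVariable hP hm hM hF hw hN ⟨i, hi⟩ s' hs
  · intro s' hs
    rw [hs.r6, hs.r7]; omega
  · intro i hi
    have h1 := G.windowsBefore_succ P.length ⟨i, hi⟩
    have h2 := G.windowsBefore_le P.length ⟨i, hi⟩
    simp only at h1 h2
    omega
  · omega
  · exact ⟨by simp [h0], by simp, by simp, by simp, by simp, by simp, by simp, by simp, by simp,
      fun i hi => absurd hi (Nat.not_lt_zero _)⟩
  · simp only [G.windowsBefore_zero]; omega
  intro s' hs
  let last : Fin G.size := ⟨G.size - 1, by omega⟩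
  have hlast : G.Good last := List.infix_rfl
  have hself := (hs.blocks last (by simp only [last]; omega) hlast).self
  obtain ⟨a, ha⟩ : ∃ a, s'.mem (F + 9 * last + 7) = a := ⟨_, rfl⟩
  obtain ⟨o, ho⟩ : ∃ o, s'.mem (F + 9 * last + 8) = o := ⟨_, rfl⟩
  rw [ha, ho] at hself
  have hl : last.val + 1 = G.size := by simp only [last]; omega
  refine Runs.store 0 (F + 9 * G.size) hs.r0 hs.r7 ?_
  refine Runs.minusEq (F + 9 * last + 8) (by simp [hs.r6, hs.r1]; omega)
    (by simp [hs.r1]; omega) ?_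
  refine Runs.load (o % 2 ^ w) (by simp [MachineState.put_mem, ho]) ?_
  refine Runs.minusEq (F + 9 * last + 7) (by simp [hs.r1]) (by simp [hs.r1]; omega) ?_
  refine Runs.load (a % 2 ^ w) (by simp [MachineState.put_mem, ha]) ?_
  refine Runs.store (F + 9 * G.size) (a % 2 ^ w) (by simp [hs.r7]) (by simp) ?_
  refine Runs.plusEq (F + 9 * G.size + 1) (by simp [hs.r7, hs.r1]) (by omega) ?_
  refine Runs.store (F + 9 * G.size + 1) (o % 2 ^ w) (by simp) (by simp) ?_
  refine Runs.nil ⟨?_, ?_, a % 2 ^ w, o % 2 ^ w, ?_, ?_, ?_⟩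
  · intro j hg
    have hj := j.2
    have hwj := G.windowsBefore_le P.length j
    refine ⟨_, ?_, (hs.blocks j hj hg).congr ?_ ?_⟩
    · omega
    · intro x h h'
      simp only [MachineState.set_mem, MachineState.put_mem]
      rw [if_neg (by omega), if_neg (by omega), if_neg (by omega)]
    · intro x h h'
      simp only [MachineState.set_mem, MachineState.put_mem]
      rw [if_neg (by omega), if_neg (by omega), if_neg (by omega)]
  · simp only [MachineState.set_mem, MachineState.put_mem]
    rw [if_neg (by omega), if_neg (by omega), if_pos trivial]
  · simp [MachineState.put_mem]
  · simp [MachineState.put_mem]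
  · rw [hl] at hself
    exact hself.mod (by have := hlast.length_le; omega) (by omega)

theorem preparesAndLists_of_runs {pre : Cmd} {mem : ℕ → ℕ} {T₁ : ℕ} (hP : 1 ≤ P.length)
    (hF : 0 < F) (hw : F + 11 * G.size + 4 < 2 ^ w) (hN : G.text.length < 2 ^ w)
    (h : Runs w acc pre (.start mem) T₁ fun s' =>
      (∀ j, G.Good j → ∃ t, t + G.windows P.length j ≤ F ∧
        Block σ π acc G P F j t s'.mem) ∧
      s'.mem 0 = F + 9 * G.size ∧
      ∃ a o, s'.mem (F + 9 * G.size) = a ∧ s'.mem (F + 9 * G.size + 1) = o % 2 ^ w ∧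
        Entry σ π acc G P F (occ σ π acc G.text P) G.text.length G.size a o) :
    PreparesAndLists pre enumerate w acc mem T₁ (104 * (1 + (occ σ π acc G.text P).card))
      (occ σ π acc G.text P) := by
  obtain ⟨s₁, t₁, he, ht, hb, hz, a, o, ha, ho, hE⟩ := h
  obtain ⟨s₂, t₂, he', ht', hn, hs⟩ := runs_enumerate hP hF hb hw hN hz ha ho hE
  exact ⟨s₁, t₁, he, ht, s₂, t₂, he', ht', hn, hs⟩

theorem PreparesAndLists.mono {pre enum : Cmd} {mem : ℕ → ℕ} {T₁ T₂ T₁' T₂' : ℕ} {A : Finset ℕ}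
    (h : PreparesAndLists pre enum w acc mem T₁ T₂ A) (h₁ : T₁ ≤ T₁') (h₂ : T₂ ≤ T₂') :
    PreparesAndLists pre enum w acc mem T₁' T₂' A := by
  obtain ⟨s₁, t₁, he, ht, s₂, t₂, he', ht', h⟩ := h
  exact ⟨s₁, t₁, he, ht.trans h₁, s₂, t₂, he', ht'.trans h₂, h⟩

end Prepare

/-! ### Words of integers -/

theorem toWord_lt (w : ℕ) (z : ℤ) : toWord w z < 2 ^ w := by
  have h : (0 : ℤ) < 2 ^ w := by positivity
  have h1 := Int.emod_nonneg z h.ne'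
  have h2 := Int.emod_lt_of_pos z h
  unfold toWord
  zify
  rw [Int.toNat_of_nonneg h1]
  exact_mod_cast h2

theorem ofWord_toWord {w : ℕ} {z : ℤ} (hz : FitsWord w z) : ofWord w (toWord w z) = z := by
  obtain ⟨h1, h2⟩ := hz
  have h : (0 : ℤ) < 2 ^ w := by positivity
  have hc : ((toWord w z : ℕ) : ℤ) = z % 2 ^ w :=
    Int.toNat_of_nonneg (Int.emod_nonneg z h.ne')
  have hif : 2 * toWord w z < 2 ^ w ↔ 2 * (z % 2 ^ w) < 2 ^ w := by
    rw [← hc]; norm_cast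
  unfold ofWord
  rw [if_congr hif rfl rfl, hc]
  by_cases hz : 0 ≤ z
  · rw [Int.emod_eq_of_lt hz (by omega), if_pos h2]
  · have : z % 2 ^ w = z + 2 ^ w := by
      rw [← Int.add_emod_right, Int.emod_eq_of_lt (by omega) (by omega)]
    rw [this, if_neg (by omega)]; omega

/-! ### The trie representation -/

/-- Every cell of the tables belongs to the table of some variable. -/
theorem SLP.exists_windowsBefore_add {α : Type} (G : SLP α) (m : ℕ) {i : ℕ}
    (hi : i < G.totalWindows m) :
    ∃ (j : Fin G.size) (k : ℕ), k < G.windows m j ∧ i = G.windowsBefore m j + k := by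
  suffices H : ∀ n ≤ G.size, i < G.windowsBefore m n →
      ∃ (j : Fin G.size) (k : ℕ), k < G.windows m j ∧ i = G.windowsBefore m j + k from
    H G.size le_rfl (by rwa [G.windowsBefore_size])
  intro n
  induction n with
  | zero => intro _ h; rw [G.windowsBefore_zero] at h; omega
  | succ n ih =>
    intro hn h
    by_cases h' : i < G.windowsBefore m n
    · exact ih (by omega) h'
    · have := G.windowsBefore_succ m ⟨n, hn⟩
      simp only at this
      exact ⟨⟨n, hn⟩, i - G.windowsBefore m n, by omega, by simp only; omega⟩

/-- Replaces the nodes in the tables by the convolution values stored at them. The trie is no longer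
needed after that, and its address becomes the first free one. -/
def resolveNodes : Cmd :=
  .block [.const 1 1, .const 5 2, .load 2 5, .const 5 8, .load 3 5,
    .whileLt 3 2 (.block [.load 6 3, .plus 7 6 6, .plus 7 7 6, .plus 7 7 2, .plus 7 7 1,
      .load 8 7, .store 3 8, .plus 3 3 1]),
    .const 5 3, .store 5 2]

theorem runs_resolveNodes {w : ℕ} {acc : ℤ → Bool} (s : MachineState) {t n E : ℕ}
    (ht : 8 < t) (h2 : s.mem 2 = t + n) (h8 : s.mem 8 = t)
    (hE : ∀ i < n, s.mem (t + i) ≤ E) (hw : t + n + 3 * E + 1 < 2 ^ w) :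
    Runs w acc resolveNodes s (10 * n + 9) fun s' => s'.reg 0 = s.reg 0 ∧ s'.mem 3 = t + n ∧
      (∀ i < n, s'.mem (t + i) = s.mem (t + n + 3 * s.mem (t + i) + 1) % 2 ^ w) ∧
      ∀ a, a ≠ 3 → a < t → s'.mem a = s.mem a := by
  refine Runs.constEq (by omega) ?_
  refine Runs.constEq (by omega) ?_
  refine Runs.loadEq (t + n) (by simp [h2]) (by omega) ?_
  refine Runs.constEq (by omega) ?_
  refine Runs.loadEq t (by simp [h8]) (by omega) ?_
  refine Runs.cons' (T' := 3) (Runs.whileCount n (fun i s' => s'.reg 0 = s.reg 0 ∧ s'.reg 1 = 1 ∧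
    s'.reg 2 = t + n ∧ s'.reg 3 = t + i ∧
    (∀ k < i, s'.mem (t + k) = s.mem (t + n + 3 * s.mem (t + k) + 1) % 2 ^ w) ∧
    ∀ a, a < t ∨ t + i ≤ a → s'.mem a = s.mem a)
    (fun _ => 9) (fun i => 10 * (n - i) + 1) ?_ ?_ ?_ ?_ ?_) ?_ ?_
  · rintro i s' hi ⟨i0, i1, i2, i3, ik, im⟩
    refine ⟨by omega, ?_⟩
    have hv := hE i hi
    obtain ⟨v, hv'⟩ : ∃ v, s.mem (t + i) = v := ⟨_, rfl⟩
    rw [hv'] at hv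
    refine Runs.loadEq v (by rw [i3, im _ (by omega), hv']) (by omega) ?_
    refine Runs.plusEq (2 * v) (by simp; omega) (by omega) ?_
    refine Runs.plusEq (3 * v) (by simp; omega) (by omega) ?_
    refine Runs.plusEq (t + n + 3 * v) (by simp [i2]; omega) (by omega) ?_
    refine Runs.plusEq (t + n + 3 * v + 1) (by simp [i1]) (by omega) ?_
    refine Runs.load (s.mem (t + n + 3 * v + 1) % 2 ^ w) (by simp [im _ (.inr (by omega) :
      t + n + 3 * v + 1 < t ∨ t + i ≤ t + n + 3 * v + 1)]) ?_
    refine Runs.store (t + i) _ (by simp [i3]) rfl ?_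
    refine Runs.plusEq (t + (i + 1)) (by simp [i1, i3]; omega) (by omega) ?_
    refine Runs.nil ⟨by simp [i0], by simp [i1], by simp [i2], by simp, ?_, ?_⟩
    · intro k hk
      simp only [MachineState.set_mem, MachineState.put_mem]
      by_cases hki : k = i
      · subst hki; simp [hv']
      · rw [if_neg (by omega), ik k (by omega)]
    · intro a ha
      simp only [MachineState.set_mem, MachineState.put_mem]
      rw [if_neg (by omega), im a (by omega)]
  · rintro s' ⟨-, -, i2, i3, -⟩
    omega
  · intro i hi; omega
  · omega
  · exact ⟨by simp, by simp, by simp, by simp, by simp, by simp⟩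
  · omega
  rintro s' ⟨i0, i1, i2, i3, ik, im⟩
  refine Runs.constEq (by omega) ?_
  refine Runs.store 3 (t + n) (by simp) (by simp [i2]) ?_
  refine Runs.nil ⟨by simp [i0], by simp [MachineState.put_mem], ?_, ?_⟩
  · intro i hi
    simp only [MachineState.set_mem, MachineState.put_mem]
    rw [if_neg (by omega), ik i hi]
  · intro a ha ha'
    simp only [MachineState.set_mem, MachineState.put_mem]
    rw [if_neg ha, im a (.inl ha')]

section Representations

variable {α : Type} {d : ℕ} {σ π : Fin d → α → ℤ} {acc : ℤ → Bool} {G : SLP α} {P : List α}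
  {w : ℕ} {mem : ℕ → ℕ}

/-- The convolution values in the tables of variables that occur in the text are restored from their
words. -/
theorem acc_ofWord_conv (hfit : ∀ i, 1 ≤ i → i ≤ G.text.length - P.length + 1 →
      FitsWord w (conv σ π G.text P i)) {j : Fin G.size} (hg : G.Good j) {k : ℕ}
    (hk : k < G.windows P.length j) :
    ofWord w (toWord w (conv σ π (G.seam P.length j) P (k + 1)) % 2 ^ w) =
      conv σ π (G.seam P.length j) P (k + 1) := by
  rw [Nat.mod_eq_of_lt (toWord_lt _ _)]
  obtain ⟨i, h1, h2, h⟩ := G.exists_conv_text σ π P hg hk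
  rw [h]
  exact ofWord_toWord (hfit i h1 (by omega))

theorem SLP.StoresBasic.ready (h : G.StoresBasic P σ π w mem)
    (hfit : ∀ i, 1 ≤ i → i ≤ G.text.length - P.length + 1 →
      FitsWord w (conv σ π G.text P i)) : Ready G P σ π acc w 2 mem where
  numVars := h.numVars
  patLength := h.patLength
  free := h.total
  rules := h.rules
  tables j hg k hk := by
    rw [show 2 + 1 + 5 * G.size = 3 + 5 * G.size by omega, h.tables j k hk,
      acc_ofWord_conv hfit hg hk]

theorem SLP.StoredAt.congr {m b : ℕ} {mem' : ℕ → ℕ} (h : G.StoredAt m mem b)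
    (he : ∀ a, b ≤ a → a < b + 5 * G.size → mem' a = mem a) : G.StoredAt m mem' b := by
  intro j
  obtain ⟨h1, h2, h3⟩ := h j
  have hj := j.2
  refine ⟨?_, by rw [he _ (by omega) (by omega), h2], by rw [he _ (by omega) (by omega), h3]⟩
  rw [he _ (by omega) (by omega), he _ (by omega) (by omega), he _ (by omega) (by omega)]
  exact h1

theorem runs_resolveNodes_ready {T : Trie α}
    {node : Fin G.size → ℕ → Fin (T.edges + 1)} (hloc : G.Locates P.length T node)
    (h : G.StoresTrie P σ π T node w mem) (hw : 4 * G.trieSize P.length T < 2 ^ w)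
    (hfit : ∀ i, 1 ≤ i → i ≤ G.text.length - P.length + 1 →
      FitsWord w (conv σ π G.text P i)) :
    Runs w acc resolveNodes (.start mem) (10 * G.totalWindows P.length + 9) fun s' =>
      s'.reg 0 = 0 ∧ Ready G P σ π acc w 3 s'.mem := by
  have hn := G.size_pos
  unfold SLP.trieSize at hw
  have hnode : ∀ i < G.totalWindows P.length, mem (4 + 5 * G.size + i) ≤ T.edges := by
    intro i hi
    obtain ⟨j, k, hk, rfl⟩ := G.exists_windowsBefore_add P.length hi
    rw [← Nat.add_assoc, h.tables j k hk]
    exact Nat.lt_succ_iff.1 (node j k).2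
  refine (runs_resolveNodes (.start mem) (t := 4 + 5 * G.size) (n := G.totalWindows P.length)
    (E := T.edges) (by omega) h.trieAddr ?_ hnode (by omega)).mono (by omega) ?_
  · have := (h.rules ⟨0, hn⟩).2.2
    simpa [G.windowsBefore_zero, MachineState.start] using this
  rintro s' ⟨r0, m3, mt, ml⟩
  refine ⟨r0, ?_, ?_, ?_, ?_, ?_⟩
  · rw [ml 0 (by omega) (by omega)]; exact h.numVars
  · rw [ml 1 (by omega) (by omega)]; exact h.patLength
  · exact m3
  · exact h.rules.congr fun a ha ha' => ml a (by omega) (by omega)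
  · intro j hg k hk
    have hwj := G.windowsBefore_le P.length j
    obtain ⟨hdep, hstr⟩ := hloc j k hk (G.window_factor P.length hg k)
    have hval := h.values (node j k) hdep
    have hwin := conv_eq_conv_window σ π (G.seam P.length j) P (show 1 ≤ k + 1 by omega)
    rw [Nat.add_sub_cancel] at hwin
    rw [hstr, ← hwin] at hval
    have hmt := mt (G.windowsBefore P.length j + k) (by omega)
    simp only [MachineState.start] at hmt
    rw [← Nat.add_assoc, h.tables j k hk, hval] at hmt
    rw [show 3 + 1 + 5 * G.size = 4 + 5 * G.size by omega, hmt, Nat.mod_mod,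
      acc_ofWord_conv hfit hg hk]

end Representations

theorem mainTheorem4 :
    (∃ (pre enum : Cmd) (c : ℕ),
      ∀ (α : Type) (d : ℕ) (σ π : Fin d → α → ℤ) (acc : ℤ → Bool) (G : SLP α) (P : List α)
        (w : ℕ) (mem : ℕ → ℕ),
        1 ≤ P.length → P.length ≤ G.text.length →
        c * (G.text.length + G.basicSize P.length) ≤ 2 ^ w →
        (∀ i, 1 ≤ i → i ≤ G.text.length - P.length + 1 → FitsWord w (conv σ π G.text P i)) →
        (∀ a, mem a < 2 ^ w) →
        G.StoresBasic P σ π w mem →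
        PreparesAndLists pre enum w acc mem
          (c * G.basicSize P.length) (c * (1 + (occ σ π acc G.text P).card))
          (occ σ π acc G.text P)) ∧
    (∃ (pre enum : Cmd) (c : ℕ),
      ∀ (α : Type) (d : ℕ) (σ π : Fin d → α → ℤ) (acc : ℤ → Bool) (G : SLP α) (P : List α)
        (T : Trie α) (node : Fin G.size → ℕ → Fin (T.edges + 1)) (w : ℕ) (mem : ℕ → ℕ),
        1 ≤ P.length → P.length ≤ G.text.length →
        c * (G.text.length + G.trieSize P.length T) ≤ 2 ^ w →
        (∀ i, 1 ≤ i → i ≤ G.text.length - P.length + 1 → FitsWord w (conv σ π G.text P i)) →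
        (∀ a, mem a < 2 ^ w) →
        G.Locates P.length T node →
        G.StoresTrie P σ π T node w mem →
        PreparesAndLists pre enum w acc mem
          (c * G.trieSize P.length T) (c * (1 + (occ σ π acc G.text P).card))
          (occ σ π acc G.text P)) := by
  refine ⟨⟨prepare 2, enumerate, 104, ?_⟩, ⟨.seq resolveNodes (prepare 3), enumerate, 104, ?_⟩⟩
  · intro α d σ π acc G P w mem hP hm hw hfit _ hmem
    have hn := G.size_pos
    unfold SLP.basicSize at hw ⊢
    exact (preparesAndLists_of_runs (F := 3 + 5 * G.size + G.totalWindows P.length) hP (by omega)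
      (by omega) (by omega) (runs_prepare hP hm (.start mem) rfl (hmem.ready hfit) rfl (by omega)
        (by omega))).mono (by omega) le_rfl
  · intro α d σ π acc G P T node w mem hP hm hw hfit _ hloc hmem
    have hn := G.size_pos
    have hres := runs_resolveNodes_ready (acc := acc) hloc hmem (by omega) hfit
    unfold SLP.trieSize at hw ⊢
    refine (preparesAndLists_of_runs (F := 4 + 5 * G.size + G.totalWindows P.length) hP (by omega)
      (by omega) (by omega) (Runs.seq (10 * G.totalWindows P.length + 9) (hres.mono le_rfl
        fun s' hs => runs_prepare hP hm s' hs.1 hs.2 rfl (by omega) (by omega)))).mono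
      (by omega) le_rfl
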